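/- Let $\Gamma$ be a finite-dimensional phase space: a smooth (Hausdorff, second countable) manifold with a symplectic form $\omega$, i.e. a smooth, closed, non-degenerate two-form. For a smooth function $F$ on $\Gamma$ let $X_F$ be its Hamiltonian vector field, $i_{X_F}\omega=dF$, and let $\{F,G\}=\omega(X_F,X_G)$ be the Poisson bracket. Let $\gamma_1,\dots,\gamma_M$ be smooth functions on $\Gamma$ (the constraints) with constraint surface $\Gamma_c=\{x\in\Gamma:\gamma_1(x)=\dots=\gamma_M(x)=0\}$. Assume that the constraints are regular, i.e. $d\gamma_1,\dots,d\gamma_M$ are linearly independent at every point of $\Gamma_c$, and that they are all first class, i.e. $\{\gamma_a,\gamma_b\}=0$ on $\Gamma_c$ for all $a,b$. Write $X_a=X_{\gamma_a}$. The gauge orbit of a point $x\in\Gamma_c$ is the set of all points that are reached from $x$ by finitely many successive gauge transformations, where a gauge transformation moves a point along a curve $c:[0,1]\to\Gamma$ with $\dot c(t)=\sum_a N^a(t)\,X_a(c(t))$ for some continuous multipliers $N^a:[0,1]\to\mathbb R$. Theorem 5. On $\Gamma_c$ the vector fields $X_a$ are integrable and generate $M$-dimensional manifolds, the gauge orbits: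 for every $x\in\Gamma_c$ the gauge orbit of $x$ is contained in $\Gamma_c$, and it is a connected $M$-dimensional immersed submanifold of $\Gamma$ whose tangent space at each of its points is spanned by $X_1,\dots,X_M$. That is, there are a connected, Hausdorff, second countable smooth $M$-dimensional manifold $L$ and a smooth injective immersion $\iota:L\to\Gamma$ whose image is the gauge orbit of $x$ and which satisfies $d\iota_l(T_lL)=\mathrm{span}\{X_1(\iota(l)),\dots,X_M(\iota(l))\}$ for all $l\in L$. -/

import Mathlib

open scoped Manifold ContDiff

universe u v

noncomputable section

namespace ConstrainedSystem

variable {E : Type*} [NormedAddCommGroup E] [NormedSpace ℝ E]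
  {P : Type*} [TopologicalSpace P] [ChartedSpace E P]

/-- The representative of a two-form `Ω` on `P` in the preferred chart at `x₀`: the pullback of `Ω`
along the inverse of the chart. -/
def chartRep (Ω : ∀ x : P, TangentSpace 𝓘(ℝ, E) x [⋀^Fin 2]→L[ℝ] ℝ) (x₀ : P) (y : E) :
    E [⋀^Fin 2]→L[ℝ] ℝ :=
  (Ω ((chartAt E x₀).symm y)).compContinuousLinearMap
    (mfderiv 𝓘(ℝ, E) 𝓘(ℝ, E) (chartAt E x₀).symm y)

variable (E P) in
/-- A symplectic form on the manifold `P` (without boundary, modelled on `E`): a smooth, closed,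
non-degenerate two-form. -/
structure SymplecticForm where
  /-- The alternating bilinear form on each tangent space. -/
  form : ∀ x : P, TangentSpace 𝓘(ℝ, E) x [⋀^Fin 2]→L[ℝ] ℝ
  smooth : ∀ x₀ : P, ContDiffOn ℝ ∞ (chartRep form x₀) (chartAt E x₀).target
  closed : ∀ x₀ : P, ∀ y ∈ (chartAt E x₀).target, extDeriv (chartRep form x₀) y = 0
  nondegenerate : ∀ (x : P) (v : TangentSpace 𝓘(ℝ, E) x), (∀ w, form x ![v, w] = 0) → v = 0

/-- The differential `dF` of a real function at `x`, as a covector. -/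
def differential (F : P → ℝ) (x : P) : TangentSpace 𝓘(ℝ, E) x →L[ℝ] ℝ :=
  mfderiv 𝓘(ℝ, E) 𝓘(ℝ, ℝ) F x

namespace SymplecticForm

variable (Ω : SymplecticForm E P)

/-- The linear map `v ↦ i_v Ω = Ω(v, ·)` from the tangent space to its dual. -/
def flat (x : P) : TangentSpace 𝓘(ℝ, E) x →ₗ[ℝ] Module.Dual ℝ (TangentSpace 𝓘(ℝ, E) x) :=
  LinearMap.mk₂ ℝ (fun v w => Ω.form x ![v, w])
    (fun v v' w => by
      simpa using (Ω.form x).toAlternatingMap.map_vecCons_add ![w] v v')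
    (fun c v w => by
      simpa using (Ω.form x).toAlternatingMap.map_vecCons_smul ![w] c v)
    (fun v w w' => by
      have e : ∀ z, Function.update ![v, w] 1 z = ![v, z] := fun z => by
        ext i; fin_cases i <;> rfl
      have h := (Ω.form x).map_update_add ![v, w] 1 w w'
      rwa [e, e, e] at h)
    (fun c v w => by
      have e : ∀ z, Function.update ![v, w] 1 z = ![v, z] := fun z => by
        ext i; fin_cases i <;> rfl
      have h := (Ω.form x).map_update_smul ![v, w] 1 c w
      rwa [e, e] at h)

theorem flat_apply (x : P) (v w : TangentSpace 𝓘(ℝ, E) x) : Ω.flat x v w = Ω.form x ![v, w] := rfl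

theorem flat_injective (x : P) : Function.Injective (Ω.flat x) := by
  rw [injective_iff_map_eq_zero]
  intro v hv
  refine Ω.nondegenerate x v fun w => ?_
  rw [← flat_apply, hv]
  rfl

theorem flat_bijective [FiniteDimensional ℝ E] (x : P) : Function.Bijective (Ω.flat x) := by
  have : FiniteDimensional ℝ (TangentSpace 𝓘(ℝ, E) x) := inferInstanceAs (FiniteDimensional ℝ E)
  exact ⟨Ω.flat_injective x, (LinearMap.injective_iff_surjective_of_finrank_eq_finrank
    (Subspace.dual_finrank_eq (K := ℝ) (V := TangentSpace 𝓘(ℝ, E) x)).symm).1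
      (Ω.flat_injective x)⟩

variable [FiniteDimensional ℝ E]

/-- The Hamiltonian vector field `X_F`, defined by `i_{X_F} Ω = dF`. -/
def hamiltonianField (F : P → ℝ) (x : P) : TangentSpace 𝓘(ℝ, E) x :=
  (LinearEquiv.ofBijective (Ω.flat x) (Ω.flat_bijective x)).symm
    (differential F x : TangentSpace 𝓘(ℝ, E) x →L[ℝ] ℝ).toLinearMap

theorem form_hamiltonianField (F : P → ℝ) (x : P) (w : TangentSpace 𝓘(ℝ, E) x) :
    Ω.form x ![Ω.hamiltonianField F x, w] = differential F x w := by
  rw [← flat_apply]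
  exact LinearMap.congr_fun
    ((LinearEquiv.ofBijective (Ω.flat x) (Ω.flat_bijective x)).apply_symm_apply _) w

/-- The Poisson bracket `{F, G} = Ω(X_F, X_G)`. -/
def poissonBracket (F G : P → ℝ) (x : P) : ℝ :=
  Ω.form x ![Ω.hamiltonianField F x, Ω.hamiltonianField G x]

end SymplecticForm

/-- The constraint surface: the common zero set of the constraints. -/
def constraintSurface {M : ℕ} (γ : Fin M → P → ℝ) : Set P := {x | ∀ a, γ a x = 0}

variable (E) in
/-- The regularity condition on a family of smooth constraints: their differentials are linearly
independent at every point of the constraint surface. -/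
def IsRegular {M : ℕ} (γ : Fin M → P → ℝ) : Prop :=
  ∀ x ∈ constraintSurface γ,
    LinearIndependent ℝ fun a => (differential (γ a) x : TangentSpace 𝓘(ℝ, E) x →L[ℝ] ℝ)

variable [FiniteDimensional ℝ E]

/-- All constraints are first class: their Poisson brackets with all constraints vanish weakly,
that is, on the constraint surface. -/
def IsFirstClass (Ω : SymplecticForm E P) {M : ℕ} (γ : Fin M → P → ℝ) : Prop :=
  ∀ a b, ∀ x ∈ constraintSurface γ, Ω.poissonBracket (γ a) (γ b) x = 0

/-- `y` is obtained from `x` by a gauge transformation: there are continuous multipliers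
`N a : [0, 1] → ℝ` and a curve `c` on `[0, 1]` from `x` to `y` in phase space which solves
`c'(t) = ∑ a, N a t • X_a (c t)`. The flow of a single field `X_a` is a special case. -/
def GaugeStep (Ω : SymplecticForm E P) {M : ℕ} (γ : Fin M → P → ℝ) (x y : P) : Prop :=
  ∃ (N : Fin M → ℝ → ℝ) (c : ℝ → P),
    (∀ a, ContinuousOn (N a) (Set.Icc 0 1)) ∧ c 0 = x ∧ c 1 = y ∧
    ∀ t ∈ Set.Icc (0 : ℝ) 1, HasMFDerivWithinAt 𝓘(ℝ, ℝ) 𝓘(ℝ, E) c (Set.Icc 0 1) t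
      ((1 : ℝ →L[ℝ] ℝ).smulRight (∑ a, N a t • Ω.hamiltonianField (γ a) (c t)))

/-- The gauge orbit of `x`: the set of all points which are obtained from `x` by finitely many
successive gauge transformations. -/
def gaugeOrbit (Ω : SymplecticForm E P) {M : ℕ} (γ : Fin M → P → ℝ) (x : P) : Set P :=
  {y | Relation.ReflTransGen (GaugeStep Ω γ) x y}

end ConstrainedSystem

end

/-! This is Frobenius' theorem for a distribution that is controlled only on the surface `γ = 0`. In
a chart write `f = (γ_1, …, γ_M)` and `X_v = ∑ v_a X_a`. Regularity makes `f` a submersion along `f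
= 0`, so a Lipschitz map vanishing on `f = 0` is locally bounded by a multiple of `‖f‖`
(`exists_norm_le_mul_norm_of_zero`). This has two uses. Applied to `df(X_v)`, which vanishes on the
surface because the constraints are first class, it lets Grönwall's inequality keep gauge curves on
the surface. Applied to the bracket `ω(X_u, X_v)`, it shows that its differential is a combination
of the `dγ_a` on the surface. Since `dω = 0`, the field `[X_u, X_v]` is dual to minus that
differential, hence is itself a combination of the `X_a` there (`exists_lieBracket_eq`).

Locally (`exists_flowBox`) a change of frame `Y = X ∘ G` makes the fields project to the constant
fields of the parameter space. Involutivity then makes them commute on the surface, and the time-one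
solutions of `w' = Y(w) s` form a graph `φ` with `dφ = Y ∘ φ`, a plaque. Straight segments of
parameters are gauge curves, so a plaque through a point of an orbit lies in the orbit. Conversely,
by uniqueness for ODEs, a gauge curve in a box cannot leave its plaque (`IsGaugeCurve.eq_plaque`).

Hence plaques overlap in open sets and are the charts of a manifold structure on the orbit. It is
connected because gauge curves are continuous for it. It is second countable because countably many
boxes suffice, plaques of one box are disjoint or equal, and so each plaque meets only countably
many others. -/

namespace ConstrainedSystem

open Set Metric Filter Topology
open scoped NNReal RealInnerProductSpace

/-! ### Estimates near the zero set of a submersion, and dependence of ODE solutions on parameters.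
-/

section ODE

variable {E F V W : Type*} [NormedAddCommGroup E] [NormedSpace ℝ E]
  [NormedAddCommGroup F] [NormedSpace ℝ F] [NormedAddCommGroup V] [NormedSpace ℝ V]
  [NormedAddCommGroup W]

/-- A Lipschitz map which vanishes on the zero set of a submersion `f` is dominated by `f`. -/
theorem exists_norm_le_mul_norm_of_zero [CompleteSpace E] [CompleteSpace F] {f : E → F}
    {f' : E →L[ℝ] F} {p : E} (hf : HasStrictFDerivAt f f' p) (hsurj : f'.range = ⊤)
    (hfp : f p = 0) {g : E → W} {K : ℝ≥0} {s : Set E} (hg : LipschitzOnWith K g s) (hs : s ∈ 𝓝 p)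
    (hgz : ∀ y ∈ s, f y = 0 → g y = 0) :
    ∃ C : ℝ, 0 ≤ C ∧ ∀ᶠ y in 𝓝 p, ‖g y‖ ≤ C * ‖f y‖ := by
  set R := f'.nonlinearRightInverseOfSurjective hsurj with hR
  have hN : 0 < R.nnnorm := f'.nonlinearRightInverseOfSurjective_nnnorm_pos hsurj
  -- With error `R.nnnorm⁻¹ / 2`, the image of the `ε`-ball about `y` contains the ball of radius `ε
  -- / (2 * R.nnnorm)` about `f y`. Taking `ε = 2 * R.nnnorm * ‖f y‖` reaches the value `0`, so `y`
  -- has a zero `y'` of `f` within distance `ε`, and the Lipschitz bound compares `g y` with `g y' =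
  -- 0`.
  obtain ⟨t, ht, hA⟩ := hf.approximates_deriv_on_nhds (c := R.nnnorm⁻¹ / 2)
    (Or.inr (by positivity))
  obtain ⟨ρ, hρ, hball⟩ := Metric.mem_nhds_iff.1 (inter_mem hs ht)
  have hN' : (0 : ℝ) < R.nnnorm := hN
  refine ⟨K * (2 * R.nnnorm), by positivity, ?_⟩
  have hcont : ContinuousAt (fun y => 2 * (R.nnnorm : ℝ) * ‖f y‖) p :=
    continuousAt_const.mul hf.hasFDerivAt.continuousAt.norm
  have h1 : ∀ᶠ y in 𝓝 p, 2 * (R.nnnorm : ℝ) * ‖f y‖ < ρ / 2 := by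
    refine hcont.eventually_lt continuousAt_const ?_
    simpa [hfp] using hρ
  filter_upwards [h1, ball_mem_nhds p (half_pos hρ)] with y hy1 hy2
  have hsub : closedBall y (2 * R.nnnorm * ‖f y‖) ⊆ ball p ρ := fun z hz => by
    rw [mem_ball] at hy2 ⊢
    rw [mem_closedBall] at hz
    linarith [dist_triangle z y p]
  obtain ⟨y', hy', hy'0⟩ := hA.surjOn_closedBall_of_nonlinearRightInverse R
    (by positivity) (hsub.trans (hball.trans inter_subset_right))
    (show (0 : F) ∈ _ by
      rw [mem_closedBall, dist_zero_left]
      have : (((R.nnnorm : ℝ))⁻¹ - ((R.nnnorm⁻¹ / 2 : ℝ≥0) : ℝ)) * (2 * R.nnnorm * ‖f y‖)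
          = ‖f y‖ := by
        push_cast
        field_simp
        ring
      rw [this])
  have hys : y ∈ s := (hball (hsub (mem_closedBall_self (by positivity)))).1
  have hys' : y' ∈ s := (hball (hsub hy')).1
  have h := hg.dist_le_mul y hys y' hys'
  rw [hgz y' hys' hy'0, dist_zero_right] at h
  rw [mem_closedBall, dist_comm] at hy'
  calc ‖g y‖ ≤ K * dist y y' := h
    _ ≤ K * (2 * R.nnnorm * ‖f y‖) := by gcongr
    _ = _ := by ring

/-- A curve along which the derivative of `f` is dominated by `f` stays in the zero set of `f`. -/
theorem eq_zero_of_norm_fderiv_le {f : E → F} {c c' : ℝ → E} {C : ℝ}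
    (hc : ∀ t ∈ Icc (0 : ℝ) 1, HasDerivWithinAt c (c' t) (Icc 0 1) t)
    (hf : ∀ t ∈ Icc (0 : ℝ) 1, DifferentiableAt ℝ f (c t))
    (hbound : ∀ t ∈ Icc (0 : ℝ) 1, ‖fderiv ℝ f (c t) (c' t)‖ ≤ C * ‖f (c t)‖)
    (h0 : f (c 0) = 0) : ∀ t ∈ Icc (0 : ℝ) 1, f (c t) = 0 := by
  have hd : ∀ t ∈ Icc (0 : ℝ) 1,
      HasDerivWithinAt (fun t => f (c t)) (fderiv ℝ f (c t) (c' t)) (Icc 0 1) t := fun t ht =>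
    (hf t ht).hasFDerivAt.comp_hasDerivWithinAt t (hc t ht)
  exact eq_zero_of_abs_deriv_le_mul_abs_self_of_eq_zero_right
    (fun t ht => (hd t ht).continuousWithinAt)
    (fun t ht => (hd t (Ico_subset_Icc_self ht)).mono_of_mem_nhdsWithin
      (Icc_mem_nhdsGE_of_mem ht)) h0
    fun t ht => hbound t (Ico_subset_Icc_self ht)

/-- Second order Taylor estimate for a map with Lipschitz derivative on a convex set. -/
theorem norm_taylor_le {Y : E → F} {Y' : E → E →L[ℝ] F} {U : Set E} (hU : Convex ℝ U)
    (hY : ∀ y ∈ U, HasFDerivAt Y (Y' y) y) {L : ℝ≥0} (hL : LipschitzOnWith L Y' U) {a b : E}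
    (ha : a ∈ U) (hb : b ∈ U) : ‖Y b - Y a - Y' a (b - a)‖ ≤ L * ‖b - a‖ ^ 2 := by
  have hsub : segment ℝ a b ⊆ U := hU.segment_subset ha hb
  have h := (convex_segment a b).norm_image_sub_le_of_norm_hasFDerivWithin_le' (φ := Y' a)
    (C := L * ‖b - a‖) (fun y hy => (hY y (hsub hy)).hasFDerivWithinAt)
    (fun y hy => ?_) (left_mem_segment ℝ a b) (right_mem_segment ℝ a b)
  · calc _ ≤ _ := h
      _ = _ := by ring
  · refine (hL.norm_sub_le (hsub hy) ha).trans ?_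
    gcongr
    obtain ⟨θ, hθ, rfl⟩ := segment_eq_image' ℝ a b ▸ hy
    rw [add_sub_cancel_left, norm_smul, Real.norm_eq_abs, abs_of_nonneg hθ.1]
    exact mul_le_of_le_one_left (norm_nonneg _) hθ.2

theorem gronwallBound_zero_eq_mul (K ε x : ℝ) :
    gronwallBound 0 K ε x = gronwallBound 0 K 1 x * ε := by
  unfold gronwallBound
  split_ifs <;> ring

/-- Solutions of `w' = Y(w) s` on `[0, 1]`, with the parameter `s`, are differentiable in `s` at
time one, with derivative `Y`, if the fields `Y(·) v` commute along them. -/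
theorem hasFDerivAt_endpoint {Y : E → V →L[ℝ] E} {Y' : E → E →L[ℝ] V →L[ℝ] E} {p z : E}
    {R ρ : ℝ} {K L K₀ : ℝ≥0} (hρ : ρ < R) (hY : ∀ y ∈ ball p R, HasFDerivAt Y (Y' y) y)
    (hL : LipschitzOnWith L Y' (ball p R)) (hK : LipschitzOnWith K Y (ball p R))
    (hK₀ : ∀ y ∈ ball p R, ‖Y y‖ ≤ K₀) {w : V → ℝ → E} {S : Set V} (hS : IsOpen S)
    (hw0 : ∀ s ∈ S, w s 0 = z) (hwρ : ∀ s ∈ S, ∀ t ∈ Icc (0 : ℝ) 1, w s t ∈ closedBall p ρ)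
    (hw : ∀ s ∈ S, ∀ t ∈ Icc (0 : ℝ) 1, HasDerivWithinAt (w s) (Y (w s t) s) (Icc 0 1) t)
    (hcomm : ∀ s ∈ S, ∀ t ∈ Icc (0 : ℝ) 1, ∀ u v,
      Y' (w s t) (Y (w s t) u) v = Y' (w s t) (Y (w s t) v) u)
    {s : V} (hs : s ∈ S) : HasFDerivAt (fun s => w s 1) (Y (w s 1)) s := by
  have hsub : closedBall p ρ ⊆ ball p R := closedBall_subset_ball hρ
  have hK' : ∀ y ∈ ball p R, ‖Y' y‖ ≤ K := fun y hy =>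
    (hY y hy).le_of_lipschitzOn (isOpen_ball.mem_nhds hy) hK
  set A : ℝ := K * K₀ + L * K₀ ^ 2 * (‖s‖ + 1) with hA
  set G : ℝ := gronwallBound 0 (K * (‖s‖ + 1) : ℝ) 1 1 with hG
  -- The curve `w s t + t • Y (w s t) h` solves the equation with parameter `s + h` up to an error
  -- `A * ‖h‖ ^ 2`. Grönwall's inequality, with factor `G`, turns this into a quadratic bound on its
  -- distance to `w (s + h)` at time one.
  have key : ∀ᶠ h in 𝓝 (0 : V), ‖w (s + h) 1 - w s 1 - Y (w s 1) h‖ ≤ G * A * ‖‖h‖ ^ 2‖ := by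
    have e1 : ∀ᶠ h in 𝓝 (0 : V), s + h ∈ S :=
      (continuous_const_add s).continuousAt.preimage_mem_nhds (by simpa using hS.mem_nhds hs)
    have e2 : ∀ᶠ h in 𝓝 (0 : V), K₀ * ‖h‖ < R - ρ := by
      have : ContinuousAt (fun h : V => K₀ * ‖h‖) 0 := by fun_prop
      exact this.eventually_lt continuousAt_const (by simpa using hρ)
    have e3 : ∀ᶠ h in 𝓝 (0 : V), ‖h‖ < 1 := by
      filter_upwards [ball_mem_nhds (0 : V) one_pos] with h hh using by simpa using hh
    filter_upwards [e1, e2, e3] with h h1 h2 h3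
    have hδ : ∀ t ∈ Icc (0 : ℝ) 1, ‖t • Y (w s t) h‖ ≤ K₀ * ‖h‖ := fun t ht => by
      rw [norm_smul, Real.norm_eq_abs, abs_of_nonneg ht.1]
      calc t * ‖Y (w s t) h‖ ≤ 1 * (K₀ * ‖h‖) := by
            gcongr
            · exact ht.2
            · exact (Y (w s t)).le_of_opNorm_le (hK₀ _ (hsub (hwρ s hs t ht))) h
        _ = _ := one_mul _
    have hmem : ∀ t ∈ Icc (0 : ℝ) 1, w s t + t • Y (w s t) h ∈ ball p R := fun t ht => by
      have := hwρ s hs t ht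
      have h4 := hδ t ht
      rw [mem_closedBall, dist_eq_norm] at this
      rw [mem_ball, dist_eq_norm]
      calc ‖w s t + t • Y (w s t) h - p‖ = ‖(w s t - p) + t • Y (w s t) h‖ := by congr 1; abel
        _ ≤ ‖w s t - p‖ + ‖t • Y (w s t) h‖ := norm_add_le _ _
        _ < R := by linarith
    have hfd : ∀ t ∈ Icc (0 : ℝ) 1, HasDerivWithinAt (fun t => w s t + t • Y (w s t) h)
        (Y (w s t) s + (t • Y' (w s t) (Y (w s t) s) h + Y (w s t) h)) (Icc 0 1) t :=
      fun t ht => by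
        have hw1 := hw s hs t ht
        have h5 : HasDerivWithinAt (fun t => Y (w s t)) (Y' (w s t) (Y (w s t) s)) (Icc 0 1) t :=
          (hY _ (hsub (hwρ s hs t ht))).comp_hasDerivWithinAt t hw1
        have h6 : HasDerivWithinAt (fun t => Y (w s t) h) (Y' (w s t) (Y (w s t) s) h)
            (Icc 0 1) t := by
          simpa using h5.clm_apply (hasDerivWithinAt_const t _ h)
        simpa using! hw1.add ((hasDerivWithinAt_id t _).smul h6)
    have toIci : ∀ {f : ℝ → E} {f' : E} {t : ℝ}, t ∈ Ico (0 : ℝ) 1 →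
        HasDerivWithinAt f f' (Icc 0 1) t → HasDerivWithinAt f f' (Ici t) t := fun ht hf =>
      hf.mono_of_mem_nhdsWithin (Icc_mem_nhdsGE_of_mem ht)
    have hgr := dist_le_of_approx_trajectories_ODE_of_mem
      (v := fun _ y => Y y (s + h)) (s := fun _ => ball p R) (K := K * (‖s‖₊ + 1))
      (f := fun t => w s t + t • Y (w s t) h)
      (g := w (s + h)) (a := 0) (b := 1) (δ := 0) (εf := A * ‖h‖ ^ 2) (εg := 0)
      (g' := fun t => Y (w (s + h) t) (s + h))
      (fun t _ => ?_)
      (fun t ht => (hfd t ht).continuousWithinAt)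
      (fun t ht => toIci ht (hfd t (Ico_subset_Icc_self ht)))
      (fun t ht => ?_)
      (fun t ht => hmem t (Ico_subset_Icc_self ht))
      (fun t ht => (hw _ h1 t ht).continuousWithinAt)
      (fun t ht => toIci ht (hw _ h1 t (Ico_subset_Icc_self ht)))
      (fun t _ => (dist_self _).le)
      (fun t ht => hsub (hwρ _ h1 t (Ico_subset_Icc_self ht)))
      (by simp [hw0 s hs, hw0 _ h1]) 1 (by simp)
    · rw [gronwallBound_zero_eq_mul] at hgr
      simp only [one_smul, sub_zero, add_zero] at hgr
      rw [dist_comm, dist_eq_norm] at hgr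
      rw [norm_pow, norm_norm, mul_assoc, sub_sub]
      simpa [hG] using hgr
    · refine LipschitzOnWith.of_dist_le_mul fun a ha b hb => ?_
      rw [dist_eq_norm, ← sub_apply]
      refine ((Y a - Y b).le_opNorm _).trans ?_
      have h8 := hK.dist_le_mul a ha b hb
      rw [dist_eq_norm] at h8
      have h9 : ‖s + h‖ ≤ ‖s‖ + 1 := (norm_add_le _ _).trans (by linarith)
      calc ‖Y a - Y b‖ * ‖s + h‖ ≤ (K * dist a b) * (‖s‖ + 1) := by gcongr
        _ = _ := by push_cast; ring
    · have ht' := Ico_subset_Icc_self ht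
      set y := w s t with hy
      have hyb : y ∈ ball p R := hsub (hwρ s hs t ht')
      set δ := t • Y y h with hδdef
      have hT := norm_taylor_le (convex_ball p R) hY hL hyb (hmem t ht')
      rw [add_sub_cancel_left] at hT
      set r := Y (y + δ) - Y y - Y' y δ with hr
      have hYr : Y (y + δ) = Y y + Y' y δ + r := by rw [hr]; abel
      -- Commutativity enters here: it identifies the term from differentiating `t • Y (w s t) h`
      -- with the first-order variation of `Y` in the direction `δ`. All that remains is quadratic
      -- in `h`.
      have hδs : Y' y δ s = t • Y' y (Y y s) h := by
        rw [hδdef, map_smul, smul_apply, hcomm s hs t ht' h s]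
      have heq : Y y s + (t • Y' y (Y y s) h + Y y h) - Y (y + δ) (s + h)
          = -(Y' y δ h + r (s + h)) := by
        rw [hYr]
        simp only [add_apply, map_add, hδs]
        abel
      rw [dist_eq_norm, heq, norm_neg]
      have hδn : ‖δ‖ ≤ K₀ * ‖h‖ := hδ t ht'
      have h9 : ‖s + h‖ ≤ ‖s‖ + 1 := (norm_add_le _ _).trans (by linarith)
      calc ‖Y' y δ h + r (s + h)‖ ≤ ‖Y' y δ h‖ + ‖r (s + h)‖ := norm_add_le _ _
        _ ≤ ‖Y' y‖ * ‖δ‖ * ‖h‖ + ‖r‖ * ‖s + h‖ :=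
            add_le_add ((Y' y).le_opNorm₂ δ h) (r.le_opNorm _)
        _ ≤ K * (K₀ * ‖h‖) * ‖h‖ + L * (K₀ * ‖h‖) ^ 2 * (‖s‖ + 1) := by
            gcongr
            · exact hK' y hyb
            · exact hT.trans (by gcongr)
        _ = A * ‖h‖ ^ 2 := by rw [hA]; ring
  rw [hasFDerivAt_iff_isLittleO_nhds_zero]
  exact (Asymptotics.IsBigO.of_bound _ key).trans_isLittleO
    (Asymptotics.isLittleO_norm_pow_id one_lt_two)

/-- The solution given by the Picard-Lindelöf theorem, with its confinement. -/
theorem exists_solution_mem_closedBall [CompleteSpace E] {f : E → E} {p z : E}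
    {a r B K : ℝ≥0} (hB : ∀ y ∈ closedBall p a, ‖f y‖ ≤ B)
    (hK : LipschitzOnWith K f (closedBall p a)) (hBa : (B : ℝ) ≤ a - r) (hz : z ∈ closedBall p r) :
    ∃ w : ℝ → E, w 0 = z ∧ ∀ t ∈ Icc (0 : ℝ) 1, w t ∈ closedBall p a ∧
      HasDerivWithinAt w (f (w t)) (Icc 0 1) t := by
  have hf : IsPicardLindelof (fun _ => f) (tmin := 0) (tmax := 1) ⟨0, by simp⟩ p a r B K :=
    IsPicardLindelof.of_time_independent hB hK (by simpa using hBa)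
  obtain ⟨α, hα⟩ := ODE.FunSpace.exists_isFixedPt_next hf hz
  refine ⟨α.compProj, ?_, fun t ht => ⟨α.compProj_mem_closedBall hf.mul_max_le, ?_⟩⟩
  · have h := ODE.FunSpace.next_apply₀ hf hz α
    rw [hα] at h
    rw [ODE.FunSpace.compProj_of_mem (by simp)]
    exact h
  · apply ODE.hasDerivWithinAt_picard_Icc (by simp : (0 : ℝ) ∈ Icc (0 : ℝ) 1)
      hf.continuousOn_uncurry α.continuous_compProj.continuousOn
      (fun _ _ => α.compProj_mem_closedBall hf.mul_max_le) z ht |>.congr_of_mem _ ht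
    intro t' ht'
    nth_rw 1 [← hα]
    rw [ODE.FunSpace.compProj_of_mem ht', ODE.FunSpace.next_apply]

/-- A solution of `dφ = Y ∘ φ` is smooth if `Y` is. -/
theorem contDiffOn_of_hasFDerivAt_comp {Y : E → V →L[ℝ] E} {U : Set E} (hY : ContDiffOn ℝ ∞ Y U)
    {φ : V → E} {S : Set V} (hS : IsOpen S) (hφU : MapsTo φ S U)
    (hφ : ∀ s ∈ S, HasFDerivAt φ (Y (φ s)) s) : ContDiffOn ℝ ∞ φ S := by
  rw [contDiffOn_infty]
  intro n
  induction n with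
  | zero =>
    exact contDiffOn_zero.2 fun s hs => (hφ s hs).continuousAt.continuousWithinAt
  | succ n ih =>
    push_cast
    rw [contDiffOn_succ_iff_fderiv_of_isOpen hS]
    refine ⟨fun s hs => (hφ s hs).differentiableAt.differentiableWithinAt, by simp, ?_⟩
    -- Bootstrap: if `φ` is of class `C^n`, so is its derivative `Y ∘ φ`, hence `φ` is of class
    -- `C^(n+1)`.
    have h := (hY.of_le (m := n) (by exact_mod_cast le_top)).comp ih hφU
    exact h.congr fun s hs => (hφ s hs).fderiv

end ODE

/-! ### Frobenius' theorem on the zero set of a submersion. -/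

section FlowBox

variable {E F V : Type*} [NormedAddCommGroup E] [NormedSpace ℝ E]
  [NormedAddCommGroup F] [NormedSpace ℝ F] [NormedAddCommGroup V] [NormedSpace ℝ V]

/-- A box for the distribution spanned by the fields `X · v`: a region `U` with a projection
`proj` to the parameter space `V` and a change of frame `G` such that the fields `X · (G · v)`
project to `v`. Through each point of `Z` in the open set `core` there is an integral manifold
which is a graph over a fixed ball of `V`. -/
structure FlowBox (X : E → V →L[ℝ] E) (Z : Set E) where
  U : Set E
  core : Set E
  proj : E →L[ℝ] V
  G : E → V →L[ℝ] V
  K : ℝ≥0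
  center : V
  radius : ℝ
  isOpen_U : IsOpen U
  isOpen_core : IsOpen core
  contDiffOn_frame : ContDiffOn ℝ ∞ (fun y => X y ∘L G y) U
  continuousOn_X : ContinuousOn X U
  continuousOn_G : ContinuousOn G U
  lipschitzOn_frame : LipschitzOnWith K (fun y => X y ∘L G y) U
  proj_X_G : ∀ y ∈ U, ∀ v, proj (X y (G y v)) = v
  G_proj_X : ∀ y ∈ U, ∀ v, G y (proj (X y v)) = v
  exists_plaque : ∀ z ∈ core, z ∈ Z → proj z ∈ ball center radius ∧ ∃ φ : V → E, φ (proj z) = z ∧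
    ∀ s ∈ ball center radius, φ s ∈ U ∧ φ s ∈ Z ∧ proj (φ s) = s ∧
      HasFDerivAt φ (X (φ s) ∘L G (φ s)) s

/-- An integral manifold in a box, as a graph over the ball of parameters. -/
def FlowBox.IsPlaque {X : E → V →L[ℝ] E} {Z : Set E} (b : FlowBox X Z) (φ : V → E) : Prop :=
  ∀ s ∈ ball b.center b.radius, φ s ∈ b.U ∧ φ s ∈ Z ∧ b.proj (φ s) = s ∧
    HasFDerivAt φ (X (φ s) ∘L b.G (φ s)) s

theorem FlowBox.IsPlaque.contDiffOn {X : E → V →L[ℝ] E} {Z : Set E} {b : FlowBox X Z} {φ : V → E}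
    (h : b.IsPlaque φ) : ContDiffOn ℝ ∞ φ (ball b.center b.radius) :=
  contDiffOn_of_hasFDerivAt_comp b.contDiffOn_frame isOpen_ball (fun s hs => (h s hs).1)
    fun s hs => (h s hs).2.2.2

/-- If the fields `X · v` are tangent to the zero set of the submersion `f`, then the derivative
of `f` along them is dominated by `f`. -/
theorem exists_norm_fderiv_comp_le [CompleteSpace E] [CompleteSpace F] {f : E → F} {p : E}
    {T : Set E} (hT : IsOpen T) (hp : p ∈ T) (hf : ContDiffOn ℝ ∞ f T)
    (hsurj : (fderiv ℝ f p).range = ⊤) (hfp : f p = 0) {X : E → V →L[ℝ] E}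
    (hX : ContDiffAt ℝ ∞ X p) (htan : ∀ y ∈ T, f y = 0 → ∀ v, fderiv ℝ f y (X y v) = 0) :
    ∃ C : ℝ, 0 ≤ C ∧ ∀ᶠ y in 𝓝 p, ‖fderiv ℝ f y ∘L X y‖ ≤ C * ‖f y‖ := by
  have hfp' : ContDiffAt ℝ ∞ f p := hf.contDiffAt (hT.mem_nhds hp)
  have hg : ContDiffAt ℝ 1 (fun y => fderiv ℝ f y ∘L X y) p :=
    (hfp'.fderiv_right (m := 1) (by norm_cast)).clm_comp (hX.of_le (by norm_cast))
  obtain ⟨K, s, hs, hK⟩ := hg.exists_lipschitzOnWith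
  exact exists_norm_le_mul_norm_of_zero (hfp'.hasStrictFDerivAt (by simp)) hsurj hfp
    (hK.mono inter_subset_left) (inter_mem hs (hT.mem_nhds hp)) fun y hy hy0 => by
      ext v
      exact htan y hy.2 hy0 v

/-- Existence of integral manifolds for commuting fields projecting to constant ones, tangent to
the zero set of a submersion, commuting there. -/
theorem exists_integral_graph [CompleteSpace E] [CompleteSpace F]
    {f : E → F} {p : E} {T : Set E} (hT : IsOpen T) (hp : p ∈ T) (hf : ContDiffOn ℝ ∞ f T)
    (hsurj : (fderiv ℝ f p).range = ⊤) (hfp : f p = 0) {Y : E → V →L[ℝ] E}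
    (hY : ContDiffOn ℝ ∞ Y T) (htan : ∀ y ∈ T, f y = 0 → ∀ v, fderiv ℝ f y (Y y v) = 0)
    (hcomm : ∀ y ∈ T, f y = 0 → ∀ u v, fderiv ℝ Y y (Y y u) v = fderiv ℝ Y y (Y y v) u)
    {π : E →L[ℝ] V} (hπ : ∀ y ∈ T, ∀ v, π (Y y v) = v) :
    ∃ R > 0, ∃ r > 0, ∃ K, ball p R ⊆ T ∧ LipschitzOnWith K Y (ball p R) ∧
      ∀ z ∈ ball p (R / 2), f z = 0 → π z ∈ ball (π p) r → ∃ φ : V → E, φ (π z) = z ∧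
        ∀ s ∈ ball (π p) r, φ s ∈ ball p R ∧ f (φ s) = 0 ∧ π (φ s) = s ∧
          HasFDerivAt φ (Y (φ s)) s := by
  have hYp : ContDiffAt ℝ ∞ Y p := hY.contDiffAt (hT.mem_nhds hp)
  obtain ⟨C, hC0, hC⟩ := exists_norm_fderiv_comp_le hT hp hf hsurj hfp hYp htan
  obtain ⟨K, sK, hsK, hK⟩ := (hYp.of_le (by norm_cast : (1 : ℕ∞ω) ≤ ∞)).exists_lipschitzOnWith
  obtain ⟨L, sL, hsL, hL⟩ :=
    (hYp.fderiv_right (m := 1) (by norm_cast)).exists_lipschitzOnWith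
  have hbd : ∀ᶠ y in 𝓝 p, ‖Y y‖ < ‖Y p‖ + 1 :=
    hYp.continuousAt.norm.eventually_lt continuousAt_const (by simp)
  obtain ⟨R, hR, hball⟩ := Metric.mem_nhds_iff.1
    (inter_mem (inter_mem (inter_mem hsK hsL) (hT.mem_nhds hp)) (inter_mem hC hbd))
  set K₀ : ℝ≥0 := ‖Y p‖₊ + 1 with hK₀
  have hK₀p : (0 : ℝ) < K₀ := by rw [hK₀]; positivity
  -- Solutions start within `R / 2` of `p` and must stay within `3 * R / 4` up to time one.
  -- Parameters are differences of two points of a ball of radius `r`, so the speed is at most `K₀ *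
  -- (2 * r) = R / 4`.
  set r : ℝ := R / (8 * K₀) with hr
  have hrp : 0 < r := by positivity
  have hbT : ball p R ⊆ T := fun y hy => (hball hy).1.2
  have hbK : ∀ y ∈ ball p R, ‖Y y‖ ≤ K₀ := fun y hy => by
    have := (hball hy).2.2
    simpa [hK₀] using this.le
  have hKb : LipschitzOnWith K Y (ball p R) := hK.mono fun y hy => (hball hy).1.1.1
  have hsub : closedBall p (3 * R / 4) ⊆ ball p R := closedBall_subset_ball (by linarith)
  refine ⟨R, hR, r, hrp, K, hbT, hKb, fun z hz hfz hπz => ?_⟩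
  have hsol : ∀ s : V, ∃ w : ℝ → E, s ∈ ball (0 : V) (2 * r) → w 0 = z ∧
      ∀ t ∈ Icc (0 : ℝ) 1, w t ∈ closedBall p (3 * R / 4) ∧
        HasDerivWithinAt w (Y (w t) s) (Icc 0 1) t := fun s => by
    by_cases hs : s ∈ ball (0 : V) (2 * r)
    · rw [mem_ball_zero_iff] at hs
      have hex := exists_solution_mem_closedBall (f := fun y => Y y s) (p := p) (z := z)
        (a := (3 * R / 4).toNNReal) (r := (R / 2).toNNReal) (B := K₀ * ‖s‖₊) (K := K * ‖s‖₊)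
        (fun y hy => ?_) (LipschitzOnWith.of_dist_le_mul fun a ha b hb => ?_) ?_ ?_
      · obtain ⟨w, hw⟩ := hex
        refine ⟨w, fun _ => ⟨hw.1, ?_⟩⟩
        rw [Real.coe_toNNReal _ (by linarith)] at hw
        exact hw.2
      · rw [Real.coe_toNNReal _ (by linarith)] at hy
        exact (Y y).le_of_opNorm_le (hbK y (hsub hy)) s
      · rw [Real.coe_toNNReal _ (by linarith)] at ha hb
        have h8 := hKb.dist_le_mul a (hsub ha) b (hsub hb)
        rw [dist_eq_norm] at h8
        rw [dist_eq_norm, ← sub_apply]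
        calc _ ≤ ‖Y a - Y b‖ * ‖s‖ := (Y a - Y b).le_opNorm _
          _ ≤ (K * dist a b) * ‖s‖ := by gcongr
          _ = _ := by push_cast; ring
      · rw [Real.coe_toNNReal _ (by linarith), Real.coe_toNNReal _ (by linarith)]
        push_cast
        calc (K₀ : ℝ) * ‖s‖ ≤ K₀ * (2 * r) := by gcongr
          _ = R / 4 := by rw [hr]; field_simp; norm_num
          _ = _ := by ring
      · rw [Real.coe_toNNReal _ (by linarith)]
        exact ball_subset_closedBall hz
    · exact ⟨fun _ => 0, fun h => absurd h hs⟩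
  choose w hw using hsol
  -- The fields commute only where `f = 0`, so the solutions have to be confined to that set before
  -- they are differentiated in `s`.
  have hZ : ∀ s ∈ ball (0 : V) (2 * r), ∀ t ∈ Icc (0 : ℝ) 1, f (w s t) = 0 := fun s hs =>
    eq_zero_of_norm_fderiv_le (C := C * ‖s‖) (fun t ht => ((hw s hs).2 t ht).2)
      (fun t ht => ((hf.contDiffAt (hT.mem_nhds (hbT (hsub ((hw s hs).2 t ht).1)))).differentiableAt
        (by simp)))
      (fun t ht => by
        have h := (hball (hsub ((hw s hs).2 t ht).1)).2.1
        calc _ ≤ ‖fderiv ℝ f (w s t) ∘L Y (w s t)‖ * ‖s‖ :=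
              (fderiv ℝ f (w s t) ∘L Y (w s t)).le_opNorm s
          _ ≤ (C * ‖f (w s t)‖) * ‖s‖ := by gcongr; exact h
          _ = _ := by ring)
      (by rw [(hw s hs).1, hfz])
  have hπw : ∀ s ∈ ball (0 : V) (2 * r), π (w s 1) = π z + s := fun s hs => by
    have h1 : ∀ t ∈ Icc (0 : ℝ) 1, HasDerivWithinAt (fun t => π (w s t) - t • s) 0 (Icc 0 1) t :=
      fun t ht => by
        have h2 := π.hasFDerivAt.comp_hasDerivWithinAt t ((hw s hs).2 t ht).2
        rw [hπ _ (hbT (hsub ((hw s hs).2 t ht).1))] at h2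
        have h3 := h2.sub ((hasDerivWithinAt_id t (Icc (0 : ℝ) 1)).smul_const s)
        simpa using! h3
    have h4 := (convex_Icc (0 : ℝ) 1).norm_image_sub_le_of_norm_hasDerivWithin_le h1
      (C := 0) (fun t _ => by simp) (left_mem_Icc.2 zero_le_one) (right_mem_Icc.2 zero_le_one)
    simp only [zero_mul, norm_le_zero_iff, one_smul, zero_smul, sub_zero] at h4
    rw [(hw s hs).1] at h4
    rw [← sub_eq_zero, ← h4]
    abel
  have hder : ∀ s ∈ ball (0 : V) (2 * r), HasFDerivAt (fun s => w s 1) (Y (w s 1)) s :=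
    fun s hs => hasFDerivAt_endpoint (Y' := fderiv ℝ Y) (z := z) (ρ := 3 * R / 4) (R := R)
      (K₀ := K₀) (by linarith)
      (fun y hy => ((hY.contDiffAt (hT.mem_nhds (hbT hy))).differentiableAt (by simp)).hasFDerivAt)
      (hL.mono fun y hy => (hball hy).1.1.2) hKb hbK isOpen_ball (fun s hs => (hw s hs).1)
      (fun s hs t ht => ((hw s hs).2 t ht).1) (fun s hs t ht => ((hw s hs).2 t ht).2)
      (fun s hs t ht u v => hcomm _ (hbT (hsub ((hw s hs).2 t ht).1)) (hZ s hs t ht) u v) hs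
  have hshift : ∀ s ∈ ball (π p) r, s - π z ∈ ball (0 : V) (2 * r) := fun s hs => by
    rw [mem_ball_zero_iff, ← dist_eq_norm]
    rw [mem_ball] at hs hπz
    linarith [dist_triangle_right s (π z) (π p)]
  refine ⟨fun s => w (s - π z) 1, ?_, fun s hs => ⟨hsub ((hw _ (hshift s hs)).2 1 (by simp)).1,
    hZ _ (hshift s hs) 1 (by simp), by simp [hπw _ (hshift s hs)], ?_⟩⟩
  · have h0 : (0 : V) ∈ ball (0 : V) (2 * r) := mem_ball_self (by positivity)
    have h1 : ∀ t ∈ Icc (0 : ℝ) 1, HasDerivWithinAt (w 0) 0 (Icc 0 1) t := fun t ht => by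
      simpa using ((hw 0 h0).2 t ht).2
    have h4 := (convex_Icc (0 : ℝ) 1).norm_image_sub_le_of_norm_hasDerivWithin_le h1
      (C := 0) (fun t _ => by simp) (left_mem_Icc.2 zero_le_one) (right_mem_Icc.2 zero_le_one)
    simp only [zero_mul, norm_le_zero_iff] at h4
    simp only [sub_self]
    rw [sub_eq_zero.1 h4, (hw 0 h0).1]
  · have h := (hder _ (hshift s hs)).comp s ((hasFDerivAt_id s).sub_const (π z))
    simpa using! h

/-- **Frobenius theorem**: an involutive family of fields on the zero set of a submersion, to which
they are tangent, admits a box around each point of that set where they are independent. -/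
theorem exists_flowBox [FiniteDimensional ℝ E] [FiniteDimensional ℝ V] [CompleteSpace F]
    {f : E → F} {p : E} {T : Set E} (hT : IsOpen T) (hp : p ∈ T) (hf : ContDiffOn ℝ ∞ f T)
    (hsurj : (fderiv ℝ f p).range = ⊤) (hfp : f p = 0) {X : E → V →L[ℝ] E}
    (hX : ContDiffOn ℝ ∞ X T) (hinj : Function.Injective (X p))
    (htan : ∀ y ∈ T, f y = 0 → ∀ v, fderiv ℝ f y (X y v) = 0)
    (hinv : ∀ y ∈ T, f y = 0 → ∀ u v, ∃ a,
      fderiv ℝ X y (X y u) v - fderiv ℝ X y (X y v) u = X y a) :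
    ∃ b : FlowBox X {y | f y = 0}, b.U ⊆ T ∧ p ∈ b.core := by
  have : CompleteSpace E := FiniteDimensional.complete ℝ E
  have : CompleteSpace V := FiniteDimensional.complete ℝ V
  obtain ⟨π₀, hπ₀⟩ := (X p : V →ₗ[ℝ] E).exists_leftInverse_of_injective
    (LinearMap.ker_eq_bot.2 hinj)
  set π : E →L[ℝ] V := LinearMap.toContinuousLinearMap π₀ with hπ
  have hπp : π ∘L X p = 1 := by
    ext v
    exact LinearMap.congr_fun hπ₀ v
  -- `A p` is the identity, so `A` is invertible near `p`. Its inverse `G` normalizes the frame: `π`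
  -- sends `X y (G y v)` to `v`.
  set A : E → V →L[ℝ] V := fun y => π ∘L X y with hA
  have hAc : ContDiffOn ℝ ∞ A T := contDiffOn_const.clm_comp hX
  set T' : Set E := T ∩ A ⁻¹' {a | IsUnit a} with hT'
  have hT'o : IsOpen T' := hAc.continuousOn.isOpen_inter_preimage hT Units.isOpen
  have hpT' : p ∈ T' := ⟨hp, by
    rw [mem_preimage, hA]
    simp only [hπp]
    exact isUnit_one⟩
  set G : E → V →L[ℝ] V := fun y => Ring.inverse (A y) with hG
  have hGc : ContDiffOn ℝ ∞ G T' := fun y hy => by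
    obtain ⟨a, ha⟩ := hy.2
    have h1 : ContDiffAt ℝ ∞ Ring.inverse (A y) := ha ▸ contDiffAt_ringInverse ℝ a
    exact h1.comp_contDiffWithinAt y ((hAc y hy.1).mono inter_subset_left)
  have hAG : ∀ y ∈ T', ∀ v, π (X y (G y v)) = v := fun y hy v => by
    have := Ring.mul_inverse_cancel (A y) hy.2
    exact DFunLike.congr_fun this v
  have hGA : ∀ y ∈ T', ∀ v, G y (π (X y v)) = v := fun y hy v => by
    have := Ring.inverse_mul_cancel (A y) hy.2
    exact DFunLike.congr_fun this v
  set Y : E → V →L[ℝ] E := fun y => X y ∘L G y with hYdef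
  have hYc : ContDiffOn ℝ ∞ Y T' := (hX.mono inter_subset_left).clm_comp hGc
  have hdY : ∀ y ∈ T', ∀ u v,
      fderiv ℝ Y y u v = fderiv ℝ X y u (G y v) + X y (fderiv ℝ G y u v) := fun y hy u v => by
    have h1 := ((hX.contDiffAt (hT.mem_nhds hy.1)).differentiableAt (by simp)).hasFDerivAt
    have h2 := ((hGc.contDiffAt (hT'o.mem_nhds hy)).differentiableAt (by simp)).hasFDerivAt
    rw [(h1.clm_comp h2).fderiv]
    simp [add_comm]
  have hπdY : ∀ y ∈ T', ∀ u v, π (fderiv ℝ Y y u v) = 0 := fun y hy u v => by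
    have h1 := ((hYc.contDiffAt (hT'o.mem_nhds hy)).differentiableAt (by simp)).hasFDerivAt
    have h2 : HasFDerivAt (fun y => π ∘L Y y) ((ContinuousLinearMap.compL ℝ V E V π) ∘L fderiv ℝ Y y) y :=
      (ContinuousLinearMap.compL ℝ V E V π).hasFDerivAt.comp y h1
    have h3 : (fun y => π ∘L Y y) =ᶠ[𝓝 y] fun _ => ContinuousLinearMap.id ℝ V := by
      filter_upwards [hT'o.mem_nhds hy] with x hx
      ext v
      exact hAG x hx v
    have h4 := h2.unique ((hasFDerivAt_const _ y).congr_of_eventuallyEq h3)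
    exact DFunLike.congr_fun (DFunLike.congr_fun h4 u) v
  have hcomm : ∀ y ∈ T', f y = 0 → ∀ u v,
      fderiv ℝ Y y (Y y u) v = fderiv ℝ Y y (Y y v) u := fun y hy hy0 u v => by
    obtain ⟨a, ha⟩ := hinv y hy.1 hy0 (G y u) (G y v)
    rw [← sub_eq_zero]
    -- By involutivity the commutator lies in the range of `X y`. It also lies in the kernel of `π`,
    -- because `π ∘ Y` is constant. As `π` is injective on that range, the commutator vanishes.
    have h1 : fderiv ℝ Y y (Y y u) v - fderiv ℝ Y y (Y y v) u
        = X y (a + (fderiv ℝ G y (Y y u) v - fderiv ℝ G y (Y y v) u)) := by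
      rw [hdY y hy, hdY y hy, map_add, map_sub, ← ha]
      simp only [hYdef, ContinuousLinearMap.comp_apply]
      abel
    have h2 : π (fderiv ℝ Y y (Y y u) v - fderiv ℝ Y y (Y y v) u) = 0 := by
      rw [map_sub, hπdY y hy, hπdY y hy, sub_zero]
    rw [h1] at h2 ⊢
    rw [← hGA y hy (a + _), h2, map_zero, map_zero]
  obtain ⟨R, hR, r, hr, K, hRT, hK, hφ⟩ := exists_integral_graph hT'o hpT'
    (hf.mono inter_subset_left) hsurj hfp hYc (fun y hy hy0 v => htan y hy.1 hy0 (G y v)) hcomm hAG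
  refine ⟨⟨ball p R, ball p (R / 2) ∩ π ⁻¹' ball (π p) r, π, G, K, π p, r, isOpen_ball,
    isOpen_ball.inter (isOpen_ball.preimage π.continuous), hYc.mono hRT,
    hX.continuousOn.mono (hRT.trans inter_subset_left), hGc.continuousOn.mono hRT,
    hK, fun y hy => hAG y (hRT hy), fun y hy => hGA y (hRT hy),
    fun z hz hz0 => ⟨hz.2, hφ z hz.1 hz0 hz.2⟩⟩, hRT.trans inter_subset_left,
    mem_ball_self (by positivity), ?_⟩
  exact mem_ball_self hr

end FlowBox

/-! ### Hamiltonian fields in a chart: smoothness and involutivity. -/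

section SymplecticCalculus

variable {E F V : Type*} [NormedAddCommGroup E] [NormedSpace ℝ E]
  [NormedAddCommGroup F] [NormedSpace ℝ F] [NormedAddCommGroup V] [InnerProductSpace ℝ V]

variable (E) in
/-- A two-form as a bilinear map. -/
noncomputable def bilinearOfTwoForm : (E [⋀^Fin 2]→L[ℝ] ℝ) →L[ℝ] E →L[ℝ] E →L[ℝ] ℝ :=
  (ContinuousLinearMap.compL ℝ E (E [⋀^Fin 1]→L[ℝ] ℝ) (E →L[ℝ] ℝ)
    ((ContinuousAlternatingMap.ofSubsingletonLIE (𝕜 := ℝ) (E := E) (F := ℝ) (0 : Fin 1)).symm :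
      (E [⋀^Fin 1]→L[ℝ] ℝ) →L[ℝ] E →L[ℝ] ℝ)) ∘L
    (ContinuousAlternatingMap.curryLeftLI
      (𝕜 := ℝ) (E := E) (F := ℝ) (n := 1)).toContinuousLinearMap

theorem bilinearOfTwoForm_apply (η : E [⋀^Fin 2]→L[ℝ] ℝ) (a b : E) :
    bilinearOfTwoForm E η a b = η ![a, b] := by
  simp only [bilinearOfTwoForm]
  change η (Matrix.vecCons a fun _ => b) = _
  congr 1
  ext i
  fin_cases i <;> rfl

theorem bilinearOfTwoForm_swap (η : E [⋀^Fin 2]→L[ℝ] ℝ) (a b : E) :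
    bilinearOfTwoForm E η a b = -bilinearOfTwoForm E η b a := by
  rw [bilinearOfTwoForm_apply, bilinearOfTwoForm_apply]
  refine Eq.trans ?_ (η.toAlternatingMap.map_swap ![b, a] (show (0 : Fin 2) ≠ 1 by decide))
  change η _ = η _
  congr 1
  ext i
  fin_cases i <;> simp

theorem contDiffOn_bilinearOfTwoForm {η : E → E [⋀^Fin 2]→L[ℝ] ℝ} {T : Set E}
    (hη : ContDiffOn ℝ ∞ η T) : ContDiffOn ℝ ∞ (fun y => bilinearOfTwoForm E (η y)) T := by
  have h : ContDiff ℝ ∞ (fun η => bilinearOfTwoForm E η) := by fun_prop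
  exact h.comp_contDiffOn hη

/-- The exterior derivative of a two-form is the cyclic sum of its derivatives. -/
theorem extDeriv_two_apply {η : E → E [⋀^Fin 2]→L[ℝ] ℝ} {T : Set E} (hT : IsOpen T)
    (hη : ContDiffOn ℝ ∞ η T) {y : E} (hy : y ∈ T) (a b c : E) :
    extDeriv η y ![a, b, c] = fderiv ℝ (fun y => bilinearOfTwoForm E (η y)) y a b c +
      fderiv ℝ (fun y => bilinearOfTwoForm E (η y)) y b c a +
      fderiv ℝ (fun y => bilinearOfTwoForm E (η y)) y c a b := by
  have hd : DifferentiableAt ℝ (fun y => bilinearOfTwoForm E (η y)) y :=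
    ((contDiffOn_bilinearOfTwoForm hη).contDiffAt (hT.mem_nhds hy)).differentiableAt (by simp)
  have h : ∀ a b c, fderiv ℝ (fun y => bilinearOfTwoForm E (η y)) y a b c =
      fderiv ℝ (fun y => η y ![b, c]) y a := fun a b c => by
    have h1 := ((hd.hasFDerivAt.clm_apply (hasFDerivAt_const b y)).clm_apply
      (hasFDerivAt_const c y)).fderiv
    simp only [bilinearOfTwoForm_apply] at h1
    rw [h1]
    simp
  have hs : fderiv ℝ (fun y => η y ![c, a]) y b = -fderiv ℝ (fun y => η y ![a, c]) y b := by
    simp only [← bilinearOfTwoForm_apply]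
    simp only [bilinearOfTwoForm_swap _ c a]
    rw [fderiv_fun_neg]
    rfl
  rw [h, h, h, hs, extDeriv_apply ((hη.contDiffAt (hT.mem_nhds hy)).differentiableAt (by simp))]
  have h0 : Fin.removeNth 0 ![a, b, c] = ![b, c] := by ext i; fin_cases i <;> rfl
  have h1 : Fin.removeNth 1 ![a, b, c] = ![a, c] := by ext i; fin_cases i <;> rfl
  have h2 : Fin.removeNth 2 ![a, b, c] = ![a, b] := by ext i; fin_cases i <;> rfl
  refine (Fin.sum_univ_three _).trans ?_
  rw [h0, h1, h2]
  simp

/-- If `g` is dominated by `f`, which vanishes at `y`, then `dg` vanishes on the kernel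
of `df`. -/
theorem fderiv_eq_zero_of_norm_le {W : Type*} [NormedAddCommGroup W] [NormedSpace ℝ W] {f : E → F}
    {g : E → W} {y w : E} (hf : DifferentiableAt ℝ f y) (hg : DifferentiableAt ℝ g y) (hf0 : f y = 0) {C : ℝ}
    (h : ∀ᶠ x in 𝓝 y, ‖g x‖ ≤ C * ‖f x‖) (hw : fderiv ℝ f y w = 0) : fderiv ℝ g y w = 0 := by
  have hg0 : g y = 0 := by simpa [hf0] using h.self_of_nhds
  have hl : HasDerivAt (fun t : ℝ => y + t • w) w 0 := by
    simpa using ((hasDerivAt_id (0 : ℝ)).smul_const w).const_add y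
  have hy0 : y + (0 : ℝ) • w = y := by simp
  have h1 : HasDerivAt (fun t : ℝ => f (y + t • w)) 0 0 := by
    rw [← hw]
    exact HasFDerivAt.comp_hasDerivAt_of_eq 0 hf.hasFDerivAt hl hy0.symm
  have h2 : HasDerivAt (fun t : ℝ => g (y + t • w)) (fderiv ℝ g y w) 0 :=
    HasFDerivAt.comp_hasDerivAt_of_eq 0 hg.hasFDerivAt hl hy0.symm
  -- Along the line `y + t • w` the map `f` is `o(t)`, hence so is `g`.
  refine h2.unique ?_
  rw [hasDerivAt_iff_isLittleO_nhds_zero] at h1 ⊢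
  simp only [zero_add, zero_smul, add_zero, hf0, hg0, sub_zero, smul_zero] at h1 ⊢
  refine Asymptotics.IsBigO.trans_isLittleO (Asymptotics.IsBigO.of_bound C ?_) h1
  have := hl.continuousAt.tendsto
  rw [hy0] at this
  exact this.eventually h

/-- The frame dual, by a non-degenerate smooth two-form, to the differential of a smooth map is
smooth. -/
theorem contDiffOn_of_twoForm_dual [FiniteDimensional ℝ E] [FiniteDimensional ℝ V] {T : Set E}
    (hT : IsOpen T) {η : E → E [⋀^Fin 2]→L[ℝ] ℝ} (hη : ContDiffOn ℝ ∞ η T)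
    (hnd : ∀ y ∈ T, ∀ a, (∀ b, η y ![a, b] = 0) → a = 0)
    {f : E → V} (hf : ContDiffOn ℝ ∞ f T) {X : E → V →L[ℝ] E}
    (hX : ∀ y ∈ T, ∀ v w, η y ![X y v, w] = ⟪v, fderiv ℝ f y w⟫) : ContDiffOn ℝ ∞ X T := by
  have : CompleteSpace E := FiniteDimensional.complete ℝ E
  set B : E → E →L[ℝ] E →L[ℝ] ℝ := fun y => bilinearOfTwoForm E (η y) with hB
  have hBc : ContDiffOn ℝ ∞ B T := contDiffOn_bilinearOfTwoForm hη
  set D : E → V →L[ℝ] E →L[ℝ] ℝ := fun y =>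
    (ContinuousLinearMap.compL ℝ E V ℝ).flip (fderiv ℝ f y) ∘L innerSL ℝ with hD
  have hDc : ContDiffOn ℝ ∞ D T := by
    have h1 : ContDiffOn ℝ ∞ (fderiv ℝ f) T := hf.fderiv_of_isOpen hT (by simp)
    have h2 : ContDiff ℝ ∞ fun a => (ContinuousLinearMap.compL ℝ E V ℝ).flip a := by fun_prop
    exact (h2.comp_contDiffOn h1).clm_comp contDiffOn_const
  have hequiv : ∀ y ∈ T, ∃ e : E ≃L[ℝ] (E →L[ℝ] ℝ), (e : E →L[ℝ] E →L[ℝ] ℝ) = B y :=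
    fun y hy => by
    have hinj : Function.Injective (B y : E →ₗ[ℝ] (E →L[ℝ] ℝ)) := by
      rw [injective_iff_map_eq_zero]
      intro a ha
      refine hnd y hy a fun b => ?_
      rw [← bilinearOfTwoForm_apply]
      exact DFunLike.congr_fun ha b
    have hdim : Module.finrank ℝ E = Module.finrank ℝ (E →L[ℝ] ℝ) := by
      rw [← (LinearMap.toContinuousLinearMap (𝕜 := ℝ) (E := E) (F' := ℝ)).finrank_eq]
      exact (Subspace.dual_finrank_eq (K := ℝ) (V := E)).symm
    refine ⟨(LinearEquiv.ofInjectiveOfFinrankEq _ hinj hdim).toContinuousLinearEquiv, ?_⟩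
    ext a b
    rfl
  have hXeq : ∀ y ∈ T, X y = (B y).inverse ∘L D y := fun y hy => by
    obtain ⟨e, he⟩ := hequiv y hy
    ext v
    rw [← he, ContinuousLinearMap.inverse_equiv]
    simp only [ContinuousLinearMap.comp_apply, ContinuousLinearEquiv.coe_coe]
    rw [ContinuousLinearEquiv.eq_symm_apply]
    change (e : E →L[ℝ] E →L[ℝ] ℝ) (X y v) = _
    rw [he]
    ext w
    rw [hB, bilinearOfTwoForm_apply, hX y hy]
    rfl
  refine ContDiffOn.congr (fun y hy => ?_) hXeq
  obtain ⟨e, he⟩ := hequiv y hy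
  have h1 : ContDiffAt ℝ ∞ ContinuousLinearMap.inverse (B y) := he ▸ contDiffAt_map_inverse e
  exact (h1.comp_contDiffWithinAt y (hBc y hy)).clm_comp (hDc y hy)

/-- The Hamiltonian fields of a family of first class constraints are involutive on the
constraint surface. -/
theorem exists_lieBracket_eq [FiniteDimensional ℝ E] [FiniteDimensional ℝ V]
    {T : Set E} (hT : IsOpen T) {η : E → E [⋀^Fin 2]→L[ℝ] ℝ} (hη : ContDiffOn ℝ ∞ η T)
    (hcl : ∀ y ∈ T, extDeriv η y = 0) (hnd : ∀ y ∈ T, ∀ a, (∀ b, η y ![a, b] = 0) → a = 0)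
    {f : E → V} (hf : ContDiffOn ℝ ∞ f T) {X : E → V →L[ℝ] E} (hXc : ContDiffOn ℝ ∞ X T)
    (hX : ∀ y ∈ T, ∀ v w, η y ![X y v, w] = ⟪v, fderiv ℝ f y w⟫)
    (hsurj : ∀ y ∈ T, f y = 0 → (fderiv ℝ f y).range = ⊤)
    (htan : ∀ y ∈ T, f y = 0 → ∀ v, fderiv ℝ f y (X y v) = 0) :
    ∀ y ∈ T, f y = 0 → ∀ u v, ∃ a,
      fderiv ℝ X y (X y u) v - fderiv ℝ X y (X y v) u = X y a := by
  intro y hy hy0 u v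
  have : CompleteSpace E := FiniteDimensional.complete ℝ E
  have : CompleteSpace V := FiniteDimensional.complete ℝ V
  have hTy := hT.mem_nhds hy
  have hfy : ContDiffAt ℝ ∞ f y := hf.contDiffAt hTy
  have hXd : HasFDerivAt X (fderiv ℝ X y) y :=
    ((hXc.contDiffAt hTy).differentiableAt (by simp)).hasFDerivAt
  have hfd : HasFDerivAt (fderiv ℝ f) (fderiv ℝ (fderiv ℝ f) y) y :=
    ((hfy.fderiv_right (m := 1) (by norm_cast)).differentiableAt (by simp)).hasFDerivAt
  have hsymm : IsSymmSndFDerivAt ℝ f y := hfy.isSymmSndFDerivAt (by simpa using! (by norm_cast : (2 : ℕ∞ω) ≤ ∞))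
  set B := bilinearOfTwoForm E (η y) with hB
  have hBc : ContDiffOn ℝ ∞ (fun y => bilinearOfTwoForm E (η y)) T :=
    contDiffOn_bilinearOfTwoForm hη
  set DB := fderiv ℝ (fun y => bilinearOfTwoForm E (η y)) y with hDB
  have hXv : ∀ v, HasFDerivAt (fun x => X x v) ((fderiv ℝ X y).flip v) y := fun v => by
    have := hXd.clm_apply (hasFDerivAt_const v y)
    simpa using this
  have hBd : HasFDerivAt (fun x => bilinearOfTwoForm E (η x))
      DB y := ((hBc.contDiffAt hTy).differentiableAt (by simp)).hasFDerivAt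
  -- The derivative in the direction `z` of the duality `η(X_v, w) = ⟪v, df w⟫`.
  have hdef : ∀ v z w, DB z (X y v) w + B (fderiv ℝ X y z v) w =
      ⟪v, fderiv ℝ (fderiv ℝ f) y z w⟫ := fun v z w => by
    have h1 := (hBd.clm_apply (hXv v)).clm_apply (hasFDerivAt_const w y)
    have h2 : HasFDerivAt (fun x => ⟪v, fderiv ℝ f x w⟫)
        ((innerSL ℝ v) ∘L (fderiv ℝ (fderiv ℝ f) y).flip w) y := by
      have h3 := hfd.clm_apply (hasFDerivAt_const w y)
      simp only [ContinuousLinearMap.comp_zero, zero_add] at h3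
      exact (innerSL ℝ v).hasFDerivAt.comp y h3
    have h4 : (fun x => bilinearOfTwoForm E (η x) (X x v) w) =ᶠ[𝓝 y]
        fun x => ⟪v, fderiv ℝ f x w⟫ := by
      filter_upwards [hTy] with x hx
      rw [bilinearOfTwoForm_apply, hX x hx]
    have h5 := DFunLike.congr_fun ((h1.congr_of_eventuallyEq h4.symm).unique h2) z
    simpa [add_comm] using h5
  set g : E → ℝ := fun x => bilinearOfTwoForm E (η x) (X x u) (X x v) with hg
  have hgd : HasFDerivAt g (fderiv ℝ g y) y := by
    exact ((hBd.clm_apply (hXv u)).clm_apply (hXv v)).differentiableAt.hasFDerivAt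
  have hgd' : ∀ w, fderiv ℝ g y w = DB w (X y u) (X y v) + B (fderiv ℝ X y w u) (X y v) +
      B (X y u) (fderiv ℝ X y w v) := fun w => by
    have := DFunLike.congr_fun ((hBd.clm_apply (hXv u)).clm_apply (hXv v)).fderiv w
    rw [show fderiv ℝ g y w = _ from this]
    simp only [ContinuousLinearMap.comp_apply, add_apply, ContinuousLinearMap.flip_apply, hDB, hB]
    ring
  have hDBs : ∀ a b c, DB a b c = -DB a c b := fun a b c => by
    have h1 : ∀ b c, fderiv ℝ (fun y => bilinearOfTwoForm E (η y) b c) y a = DB a b c :=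
      fun b c => by
        rw [((hBd.clm_apply (hasFDerivAt_const b y)).clm_apply (hasFDerivAt_const c y)).fderiv]
        simp
    rw [← h1, ← h1]
    simp only [bilinearOfTwoForm_swap _ b c]
    rw [fderiv_fun_neg]
    rfl
  -- The bracket `[X_u, X_v]` is dual to `-dg`, where `g = η(X_u, X_v)`. In the combination of the
  -- instances of `hdef`, the second derivatives of `f` cancel by symmetry and the derivatives of
  -- `η` cancel by closedness.
  have hkey : ∀ w, B (fderiv ℝ X y (X y u) v - fderiv ℝ X y (X y v) u) w = -fderiv ℝ g y w :=
    fun w => by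
    have e1 := hdef v (X y u) w
    have e2 := hdef u (X y v) w
    have e3 := hdef u w (X y v)
    have e4 := hdef v w (X y u)
    have e5 := extDeriv_two_apply hT hη hy (X y u) (X y v) w
    rw [hcl y hy] at e5
    have s1 := bilinearOfTwoForm_swap (η y) (X y u) (fderiv ℝ X y w v)
    have s2 := hDBs w (X y v) (X y u)
    have s3 := hDBs (X y v) (X y u) w
    rw [hsymm (X y u) w] at e1
    rw [hsymm (X y v) w] at e2
    rw [map_sub, sub_apply, hgd']
    change (0 : ℝ) = _ at e5
    simp only [hDB, hB] at *
    linarith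
  have hgc : ContDiffAt ℝ 1 g y := by
    have hXy : ContDiffAt ℝ 1 X y := (hXc.contDiffAt hTy).of_le (by norm_cast)
    exact (((hBc.contDiffAt hTy).of_le (by norm_cast)).clm_apply
      (hXy.clm_apply contDiffAt_const)).clm_apply (hXy.clm_apply contDiffAt_const)
  obtain ⟨K, s, hs, hK⟩ := hgc.exists_lipschitzOnWith
  obtain ⟨C, -, hC⟩ := exists_norm_le_mul_norm_of_zero (hfy.hasStrictFDerivAt (by simp))
    (hsurj y hy hy0) hy0 (hK.mono inter_subset_left) (inter_mem hs hTy) fun x hx hx0 => by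
      rw [hg]
      simp only
      rw [bilinearOfTwoForm_apply, hX x hx.2, htan x hx.2 hx0, inner_zero_right]
  have hker : ∀ w, fderiv ℝ f y w = 0 → fderiv ℝ g y w = 0 := fun w hw =>
    fderiv_eq_zero_of_norm_le (hfy.differentiableAt (by simp)) hgd.differentiableAt hy0 hC hw
  obtain ⟨R, hR⟩ := (fderiv ℝ f y : E →ₗ[ℝ] V).exists_rightInverse_of_surjective (hsurj y hy hy0)
  -- Lagrange multipliers: `dg` vanishes on the kernel of the surjection `df`, so it factors as `ℓ ∘
  -- df`, and the vector representing `ℓ` gives the coefficients of the bracket up to sign.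
  set ℓ : V →L[ℝ] ℝ := LinearMap.toContinuousLinearMap ((fderiv ℝ g y : E →ₗ[ℝ] ℝ) ∘ₗ R) with hℓ
  have hℓf : ∀ w, fderiv ℝ g y w = ⟪(InnerProductSpace.toDual ℝ V).symm ℓ, fderiv ℝ f y w⟫ :=
    fun w => by
    rw [InnerProductSpace.toDual_symm_apply]
    change _ = fderiv ℝ g y (R (fderiv ℝ f y w))
    rw [← sub_eq_zero, ← map_sub]
    apply hker
    rw [map_sub, sub_eq_zero]
    exact (LinearMap.congr_fun hR (fderiv ℝ f y w)).symm
  refine ⟨-(InnerProductSpace.toDual ℝ V).symm ℓ, sub_eq_zero.1 (hnd y hy _ fun w => ?_)⟩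
  rw [← bilinearOfTwoForm_apply, map_sub, sub_apply, bilinearOfTwoForm_apply _ (X y _), hX y hy,
    inner_neg_left, ← hℓf, hkey]
  simp

end SymplecticCalculus

/-! ### Constraints and symplectic form read in a chart. -/

section Chart

variable {E : Type*} [NormedAddCommGroup E] {P : Type*} [TopologicalSpace P] [ChartedSpace E P]
  {M : ℕ}

/-- The constraints in the chart at `p`. -/
noncomputable def chartConstraint (γ : Fin M → P → ℝ) (p : P) (y : E) : EuclideanSpace ℝ (Fin M) :=
  WithLp.toLp 2 fun a => γ a ((chartAt E p).symm y)

theorem chartConstraint_eq_zero_iff (γ : Fin M → P → ℝ) {p : P} {y : E} :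
    chartConstraint γ p y = 0 ↔ (chartAt E p).symm y ∈ constraintSurface γ := by
  constructor
  · intro h a
    exact congrArg (fun v : EuclideanSpace ℝ (Fin M) => v a) h
  · intro h
    ext a
    exact h a

variable [NormedSpace ℝ E] [IsManifold 𝓘(ℝ, E) ∞ P]

theorem mfderiv_chartAt_symm_comp {p : P} {y : E} (hy : y ∈ (chartAt E p).target)
    (w : TangentSpace 𝓘(ℝ, E) ((chartAt E p).symm y)) :
    mfderiv 𝓘(ℝ, E) 𝓘(ℝ, E) (chartAt E p).symm y
      (mfderiv 𝓘(ℝ, E) 𝓘(ℝ, E) (chartAt E p) ((chartAt E p).symm y) w) = w := by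
  have : IsManifold 𝓘(ℝ, E) 1 P := IsManifold.of_le (n := ∞) (by norm_cast)
  have he : (chartAt E p).MDifferentiable 𝓘(ℝ, E) 𝓘(ℝ, E) := mdifferentiable_chart p
  have h := he.symm.comp_symm_deriv (x := (chartAt E p).symm y) ((chartAt E p).map_target hy)
  have h2 := DFunLike.congr_fun h w
  rw [OpenPartialHomeomorph.symm_symm] at h2
  -- The inverse-chart derivative in `h2` is based at the chart image of `(chartAt E p).symm y`; `e`
  -- moves its base point to `y`.
  have e : ∀ y', y' = y → ∀ u : E, (mfderiv 𝓘(ℝ, E) 𝓘(ℝ, E) (chartAt E p).symm y' u : E) =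
      mfderiv 𝓘(ℝ, E) 𝓘(ℝ, E) (chartAt E p).symm y u := by
    rintro _ rfl u
    rfl
  exact (e _ ((chartAt E p).right_inv hy) _).symm.trans h2

theorem mfderiv_chartAt_symm_bijective {p : P} {y : E} (hy : y ∈ (chartAt E p).target) :
    Function.Bijective (mfderiv 𝓘(ℝ, E) 𝓘(ℝ, E) (chartAt E p).symm y) := by
  have : IsManifold 𝓘(ℝ, E) 1 P := IsManifold.of_le (n := ∞) (by norm_cast)
  have he : (chartAt E p).MDifferentiable 𝓘(ℝ, E) 𝓘(ℝ, E) := mdifferentiable_chart p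
  exact he.symm.mfderiv_bijective hy

theorem chartRep_nondegenerate (Ω : SymplecticForm E P) {p : P} {y : E} (hy : y ∈ (chartAt E p).target) (a : E)
    (ha : ∀ b, chartRep Ω.form p y ![a, b] = 0) : a = 0 := by
  have hb := mfderiv_chartAt_symm_bijective (E := E) hy
  refine hb.1 ((Ω.nondegenerate _ _ fun w => ?_).trans (map_zero _).symm)
  obtain ⟨b, rfl⟩ := hb.2 w
  rw [← ha b]
  change _ = Ω.form ((chartAt E p).symm y) _
  congr 1
  ext i
  fin_cases i <;> rfl

variable {γ : Fin M → P → ℝ}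

theorem contDiffOn_chartConstraint
    (hγ : ∀ a, ContMDiff 𝓘(ℝ, E) 𝓘(ℝ, ℝ) ∞ (γ a)) (p : P) :
    ContDiffOn ℝ ∞ (chartConstraint γ p) (chartAt E p).target := by
  have h : ∀ a, ContDiffOn ℝ ∞ (fun y => γ a ((chartAt E p).symm y)) (chartAt E p).target :=
    fun a => by
      rw [← contMDiffOn_iff_contDiffOn]
      exact (hγ a).comp_contMDiffOn contMDiffOn_chart_symm
  exact contDiffOn_euclidean.2 h

theorem fderiv_chartConstraint_apply
    (hγ : ∀ a, ContMDiff 𝓘(ℝ, E) 𝓘(ℝ, ℝ) ∞ (γ a)) {p : P} {y : E} (hy : y ∈ (chartAt E p).target) (w : E)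
    (a : Fin M) : fderiv ℝ (chartConstraint γ p) y w a =
      differential (γ a) ((chartAt E p).symm y)
        (mfderiv 𝓘(ℝ, E) 𝓘(ℝ, E) (chartAt E p).symm y w) := by
  have : IsManifold 𝓘(ℝ, E) 1 P := IsManifold.of_le (n := ∞) (by norm_cast)
  have he : (chartAt E p).MDifferentiable 𝓘(ℝ, E) 𝓘(ℝ, E) := mdifferentiable_chart p
  have h1 : HasFDerivAt (chartConstraint γ p) (fderiv ℝ (chartConstraint γ p) y) y :=
    (((contDiffOn_chartConstraint hγ p).contDiffAt
      ((chartAt E p).open_target.mem_nhds hy)).differentiableAt (by simp)).hasFDerivAt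
  have h2 : HasFDerivAt (fun y => γ a ((chartAt E p).symm y))
      (EuclideanSpace.proj a ∘L fderiv ℝ (chartConstraint γ p) y) y :=
    (EuclideanSpace.proj (𝕜 := ℝ) a).hasFDerivAt.comp y h1
  have h3 : HasMFDerivAt 𝓘(ℝ, E) 𝓘(ℝ, ℝ) (fun y => γ a ((chartAt E p).symm y)) y
      ((mfderiv 𝓘(ℝ, E) 𝓘(ℝ, ℝ) (γ a) ((chartAt E p).symm y)).comp
        (mfderiv 𝓘(ℝ, E) 𝓘(ℝ, E) (chartAt E p).symm y)) :=
    HasMFDerivAt.comp y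
      (((hγ a).mdifferentiable (by simp)) ((chartAt E p).symm y)).hasMFDerivAt
      (he.mdifferentiableAt_symm hy).hasMFDerivAt
  exact DFunLike.congr_fun (h2.unique h3.hasFDerivAt) w

theorem inner_fderiv_chartConstraint
    (hγ : ∀ a, ContMDiff 𝓘(ℝ, E) 𝓘(ℝ, ℝ) ∞ (γ a)) {p : P} {y : E} (hy : y ∈ (chartAt E p).target)
    (v : EuclideanSpace ℝ (Fin M)) (w : E) :
    ⟪v, fderiv ℝ (chartConstraint γ p) y w⟫ =
      ∑ a, v a * differential (γ a) ((chartAt E p).symm y)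
        (mfderiv 𝓘(ℝ, E) 𝓘(ℝ, E) (chartAt E p).symm y w) := by
  rw [PiLp.inner_apply]
  refine Finset.sum_congr rfl fun a _ => ?_
  rw [fderiv_chartConstraint_apply hγ hy]
  simp [mul_comm]

/-- A vector orthogonal to the range is the coefficient vector of a linear relation among the
`dγ_a`, so regularity makes it zero. -/
theorem range_fderiv_chartConstraint
    (hγ : ∀ a, ContMDiff 𝓘(ℝ, E) 𝓘(ℝ, ℝ) ∞ (γ a))
    (hreg : IsRegular E γ) {p : P} {y : E} (hy : y ∈ (chartAt E p).target)
    (hy0 : chartConstraint γ p y = 0) : (fderiv ℝ (chartConstraint γ p) y).range = ⊤ := by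
  rw [← Submodule.orthogonal_eq_bot_iff, Submodule.eq_bot_iff]
  intro v hv
  have h1 : ∀ w, ⟪v, fderiv ℝ (chartConstraint γ p) y w⟫ = 0 := fun w => by
    rw [real_inner_comm]
    exact hv _ ⟨w, rfl⟩
  have hli := Fintype.linearIndependent_iff.1
    (hreg _ ((chartConstraint_eq_zero_iff γ).1 hy0)) v (by
      ext w
      obtain ⟨b, rfl⟩ := (mfderiv_chartAt_symm_bijective (E := E) hy).2 w
      have h2 := (inner_fderiv_chartConstraint hγ hy v b).symm.trans (h1 b)
      simpa using! h2)
  ext a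
  exact hli a

end Chart

/-! ### The gauge fields in a chart and their boxes. -/

section GaugeField

variable {E : Type*} [NormedAddCommGroup E] [NormedSpace ℝ E] [FiniteDimensional ℝ E]
  {P : Type*} [TopologicalSpace P] [ChartedSpace E P]
  (Ω : SymplecticForm E P) {M : ℕ} (γ : Fin M → P → ℝ)

/-- The linear combinations of the Hamiltonian fields of the constraints. -/
noncomputable def gaugeField (x : P) : EuclideanSpace ℝ (Fin M) →L[ℝ] TangentSpace 𝓘(ℝ, E) x :=
  LinearMap.toContinuousLinearMap
    { toFun := fun v => ∑ a, v a • Ω.hamiltonianField (γ a) x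
      map_add' := fun v w => by simp [add_smul, Finset.sum_add_distrib]
      map_smul' := fun c v => by simp [mul_smul, Finset.smul_sum] }

theorem gaugeField_apply (x : P) (v : EuclideanSpace ℝ (Fin M)) :
    gaugeField Ω γ x v = ∑ a, v a • Ω.hamiltonianField (γ a) x := rfl

/-- The fields `gaugeField` in the chart at `p`. -/
noncomputable def chartField (p : P) (y : E) : EuclideanSpace ℝ (Fin M) →L[ℝ] E :=
  (mfderiv 𝓘(ℝ, E) 𝓘(ℝ, E) (chartAt E p) ((chartAt E p).symm y)).comp
    (gaugeField Ω γ ((chartAt E p).symm y))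

theorem range_gaugeField (x : P) :
    range (gaugeField Ω γ x) =
      Submodule.span ℝ (range fun a => Ω.hamiltonianField (γ a) x) := by
  ext w
  rw [SetLike.mem_coe, Submodule.mem_span_range_iff_exists_fun]
  constructor
  · rintro ⟨v, rfl⟩
    exact ⟨v, rfl⟩
  · rintro ⟨c, rfl⟩
    exact ⟨WithLp.toLp 2 c, rfl⟩

theorem chartField_apply {p x : P} (hx : x ∈ (chartAt E p).source)
    (v : EuclideanSpace ℝ (Fin M)) :
    chartField Ω γ p (chartAt E p x) v =
      mfderiv 𝓘(ℝ, E) 𝓘(ℝ, E) (chartAt E p) x (gaugeField Ω γ x v) := by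
  have h : ∀ x', x' = x → ((mfderiv 𝓘(ℝ, E) 𝓘(ℝ, E) (chartAt E p) x' (gaugeField Ω γ x' v) : E)) =
      mfderiv 𝓘(ℝ, E) 𝓘(ℝ, E) (chartAt E p) x (gaugeField Ω γ x v) := by
    rintro _ rfl
    rfl
  exact h _ ((chartAt E p).left_inv hx)

theorem form_gaugeField (x : P) (v : EuclideanSpace ℝ (Fin M)) (w : TangentSpace 𝓘(ℝ, E) x) :
    Ω.form x ![gaugeField Ω γ x v, w] = ∑ a, v a * differential (γ a) x w := by
  rw [← Ω.flat_apply, gaugeField_apply, map_sum, LinearMap.sum_apply]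
  refine Finset.sum_congr rfl fun a _ => ?_
  rw [map_smul, LinearMap.smul_apply, Ω.flat_apply, Ω.form_hamiltonianField, smul_eq_mul]

variable [IsManifold 𝓘(ℝ, E) ∞ P]

theorem mfderiv_chartAt_symm_chartField {p : P} {y : E} (hy : y ∈ (chartAt E p).target)
    (v : EuclideanSpace ℝ (Fin M)) :
    mfderiv 𝓘(ℝ, E) 𝓘(ℝ, E) (chartAt E p).symm y (chartField Ω γ p y v) =
      gaugeField Ω γ ((chartAt E p).symm y) v :=
  mfderiv_chartAt_symm_comp hy _

variable {γ}

/-- The defining equation `i_{X_F} ω = dF` in the chart. Smoothness, independence and involutivity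
of the fields all rest on this duality. -/
theorem chartRep_chartField
    (hγ : ∀ a, ContMDiff 𝓘(ℝ, E) 𝓘(ℝ, ℝ) ∞ (γ a)) {p : P} {y : E} (hy : y ∈ (chartAt E p).target)
    (v : EuclideanSpace ℝ (Fin M)) (w : E) :
    chartRep Ω.form p y ![chartField Ω γ p y v, w] = ⟪v, fderiv ℝ (chartConstraint γ p) y w⟫ := by
  rw [inner_fderiv_chartConstraint hγ hy, ← form_gaugeField Ω γ,
    ← mfderiv_chartAt_symm_chartField Ω γ hy]
  change Ω.form ((chartAt E p).symm y) _ = _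
  congr 1
  ext i
  fin_cases i <;> rfl

/-- If `X_v = 0`, then by duality `v` is orthogonal to the range of `df`, which is everything on the
surface. -/
theorem chartField_injective
    (hγ : ∀ a, ContMDiff 𝓘(ℝ, E) 𝓘(ℝ, ℝ) ∞ (γ a))
    (hreg : IsRegular E γ) {p : P} {y : E} (hy : y ∈ (chartAt E p).target)
    (hy0 : chartConstraint γ p y = 0) : Function.Injective (chartField Ω γ p y) := by
  rw [injective_iff_map_eq_zero]
  intro v hv
  have hr := range_fderiv_chartConstraint hγ hreg hy hy0
  obtain ⟨w, hw⟩ := LinearMap.range_eq_top.1 hr v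
  have h := chartRep_chartField Ω hγ hy v w
  rw [hv] at h
  have h0 : chartRep Ω.form p y ![0, w] = 0 :=
    (chartRep Ω.form p y).map_coord_zero (m := ![0, w]) 0 rfl
  rw [h0] at h
  change fderiv ℝ (chartConstraint γ p) y w = v at hw
  rw [hw] at h
  exact inner_self_eq_zero.1 h.symm

/-- Component `a` is the combination of the brackets `{γ_a, γ_b}` with coefficients `v_b`. -/
theorem fderiv_chartConstraint_chartField
    (hγ : ∀ a, ContMDiff 𝓘(ℝ, E) 𝓘(ℝ, ℝ) ∞ (γ a)) (hfirst : IsFirstClass Ω γ) {p : P} {y : E}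
    (hy : y ∈ (chartAt E p).target) (hy0 : chartConstraint γ p y = 0)
    (v : EuclideanSpace ℝ (Fin M)) :
    fderiv ℝ (chartConstraint γ p) y (chartField Ω γ p y v) = 0 := by
  ext a
  rw [fderiv_chartConstraint_apply hγ hy, mfderiv_chartAt_symm_chartField Ω γ hy,
    ← Ω.form_hamiltonianField, gaugeField_apply, ← Ω.flat_apply, map_sum]
  refine Finset.sum_eq_zero fun b _ => ?_
  rw [map_smul, Ω.flat_apply]
  have := hfirst a b _ ((chartConstraint_eq_zero_iff γ).1 hy0)
  rw [SymplecticForm.poissonBracket] at this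
  rw [this, smul_zero]

theorem contDiffOn_chartField
    (hγ : ∀ a, ContMDiff 𝓘(ℝ, E) 𝓘(ℝ, ℝ) ∞ (γ a)) (p : P) :
    ContDiffOn ℝ ∞ (chartField Ω γ p) (chartAt E p).target :=
  contDiffOn_of_twoForm_dual (chartAt E p).open_target (Ω.smooth p)
    (fun _ hy => chartRep_nondegenerate Ω hy) (contDiffOn_chartConstraint hγ p)
    fun _ hy => chartRep_chartField Ω hγ hy

/-- Around each point of the constraint surface there is a box for the gauge fields. -/
theorem exists_gaugeBox
    (hγ : ∀ a, ContMDiff 𝓘(ℝ, E) 𝓘(ℝ, ℝ) ∞ (γ a))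
    (hreg : IsRegular E γ) (hfirst : IsFirstClass Ω γ) {p : P} (hp : p ∈ constraintSurface γ) :
    ∃ b : FlowBox (chartField Ω γ p) {y | chartConstraint γ p y = 0},
      b.U ⊆ (chartAt E p).target ∧ chartAt E p p ∈ b.core := by
  have hpt : chartAt E p p ∈ (chartAt E p).target :=
    (chartAt E p).map_source (mem_chart_source E p)
  have hp0 : chartConstraint γ p (chartAt E p p) = 0 := by
    rw [chartConstraint_eq_zero_iff, (chartAt E p).left_inv (mem_chart_source E p)]
    exact hp
  have hX := contDiffOn_chartField Ω hγ p
  exact exists_flowBox (chartAt E p).open_target hpt (contDiffOn_chartConstraint hγ p)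
    (range_fderiv_chartConstraint hγ hreg hpt hp0) hp0 hX
    (chartField_injective Ω hγ hreg hpt hp0)
    (fun y hy hy0 => fderiv_chartConstraint_chartField Ω hγ hfirst hy hy0)
    (exists_lieBracket_eq (chartAt E p).open_target (Ω.smooth p) (Ω.closed p)
      (fun _ hy => chartRep_nondegenerate Ω hy) (contDiffOn_chartConstraint hγ p) hX
      (fun _ hy => chartRep_chartField Ω hγ hy)
      (fun y hy hy0 => range_fderiv_chartConstraint hγ hreg hy hy0)
      (fun y hy hy0 => fderiv_chartConstraint_chartField Ω hγ hfirst hy hy0))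

end GaugeField

/-! ### Gauge curves: confinement to the surface and to plaques. -/

section GaugeCurve

variable {E : Type*} [NormedAddCommGroup E] [NormedSpace ℝ E] [FiniteDimensional ℝ E]
  {P : Type*} [TopologicalSpace P] [ChartedSpace E P]
  {Ω : SymplecticForm E P} {M : ℕ} {γ : Fin M → P → ℝ}

variable (Ω γ) in
/-- The curve `c` on `[0, 1]` is driven by the gauge fields with continuous multipliers `N`. -/
structure IsGaugeCurve (N : ℝ → EuclideanSpace ℝ (Fin M)) (c : ℝ → P) : Prop where
  continuousOn_multiplier : ContinuousOn N (Icc 0 1)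
  hasMFDerivWithinAt : ∀ t ∈ Icc (0 : ℝ) 1, HasMFDerivWithinAt 𝓘(ℝ, ℝ) 𝓘(ℝ, E) c (Icc 0 1) t
    ((1 : ℝ →L[ℝ] ℝ).smulRight (gaugeField Ω γ (c t) (N t)))

theorem gaugeStep_iff {x y : P} :
    GaugeStep Ω γ x y ↔ ∃ N c, IsGaugeCurve Ω γ N c ∧ c 0 = x ∧ c 1 = y := by
  constructor
  · rintro ⟨N, c, hN, h0, h1, hc⟩
    refine ⟨fun t => WithLp.toLp 2 fun a => N a t, c, ⟨?_, hc⟩, h0, h1⟩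
    exact (PiLp.continuous_toLp 2 _).comp_continuousOn (continuousOn_pi.2 hN)
  · rintro ⟨N, c, hc, h0, h1⟩
    refine ⟨fun a t => N t a, c, fun a => ?_, h0, h1, hc.hasMFDerivWithinAt⟩
    exact (EuclideanSpace.proj (𝕜 := ℝ) a).continuous.comp_continuousOn hc.continuousOn_multiplier

theorem add_mul_sub_mem_Icc {t₀ t₁ τ : ℝ} (h₀ : t₀ ∈ Icc (0 : ℝ) 1)
    (h₁ : t₁ ∈ Icc (0 : ℝ) 1) (hτ : τ ∈ Icc (0 : ℝ) 1) : t₀ + τ * (t₁ - t₀) ∈ Icc (0 : ℝ) 1 := by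
  simpa using (convex_Icc (0 : ℝ) 1).add_smul_sub_mem h₀ h₁ hτ

namespace IsGaugeCurve

variable {N : ℝ → EuclideanSpace ℝ (Fin M)} {c : ℝ → P}

theorem continuousOn (hc : IsGaugeCurve Ω γ N c) : ContinuousOn c (Icc 0 1) :=
  fun t ht => (hc.hasMFDerivWithinAt t ht).continuousWithinAt

/-- A piece of a gauge curve, in either direction, is a gauge curve. -/
theorem subcurve (hc : IsGaugeCurve Ω γ N c) {t₀ t₁ : ℝ} (h₀ : t₀ ∈ Icc (0 : ℝ) 1)
    (h₁ : t₁ ∈ Icc (0 : ℝ) 1) :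
    IsGaugeCurve Ω γ (fun τ => (t₁ - t₀) • N (t₀ + τ * (t₁ - t₀)))
      (fun τ => c (t₀ + τ * (t₁ - t₀))) where
  continuousOn_multiplier := by
    have hg : ContinuousOn (fun τ : ℝ => t₀ + τ * (t₁ - t₀)) (Icc 0 1) := by fun_prop
    exact (hc.continuousOn_multiplier.comp hg
      fun τ hτ => add_mul_sub_mem_Icc h₀ h₁ hτ).const_smul (t₁ - t₀)
  hasMFDerivWithinAt τ hτ := by
    have hg : HasDerivWithinAt (fun τ => t₀ + τ * (t₁ - t₀)) (t₁ - t₀) (Icc 0 1) τ := by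
      simpa using! ((hasDerivWithinAt_id τ _).mul_const (t₁ - t₀)).const_add t₀
    have hg' := hg.hasFDerivWithinAt.hasMFDerivWithinAt
    have h := HasMFDerivWithinAt.comp τ (hc.hasMFDerivWithinAt _ (add_mul_sub_mem_Icc h₀ h₁ hτ)) hg'
      fun τ hτ => add_mul_sub_mem_Icc h₀ h₁ hτ
    refine h.congr_mfderiv ?_
    refine ContinuousLinearMap.ext fun (r : ℝ) => ?_
    change (r • (t₁ - t₀)) • gaugeField Ω γ (c (t₀ + τ * (t₁ - t₀))) (N _) =
      r • gaugeField Ω γ (c (t₀ + τ * (t₁ - t₀))) ((t₁ - t₀) • N _)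
    rw [map_smul, smul_assoc]

/-- Short pieces of a gauge curve stay in a given neighbourhood. -/
theorem eventually_subcurve_mem (hc : IsGaugeCurve Ω γ N c) {t₀ : ℝ} (h₀ : t₀ ∈ Icc (0 : ℝ) 1)
    {O : Set P} (hO : O ∈ 𝓝 (c t₀)) :
    ∀ᶠ t₁ in 𝓝[Icc 0 1] t₀, ∀ τ ∈ Icc (0 : ℝ) 1, c (t₀ + τ * (t₁ - t₀)) ∈ O := by
  obtain ⟨δ, hδ, h⟩ := Metric.mem_nhdsWithin_iff.1 (hc.continuousOn t₀ h₀ hO)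
  filter_upwards [inter_mem_nhdsWithin _ (ball_mem_nhds t₀ hδ)] with t₁ ht₁ τ hτ
  refine h ⟨?_, add_mul_sub_mem_Icc h₀ ht₁.1 hτ⟩
  have h2 := ht₁.2
  rw [mem_ball, Real.dist_eq] at h2 ⊢
  rw [add_sub_cancel_left, abs_mul, abs_of_nonneg hτ.1]
  exact (mul_le_of_le_one_left (abs_nonneg _) hτ.2).trans_lt h2

variable [IsManifold 𝓘(ℝ, E) ∞ P]

theorem hasDerivWithinAt_chart (hc : IsGaugeCurve Ω γ N c) {p : P} {t : ℝ}
    (ht : t ∈ Icc (0 : ℝ) 1) (hs : c t ∈ (chartAt E p).source) :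
    HasDerivWithinAt (fun t => chartAt E p (c t)) (chartField Ω γ p (chartAt E p (c t)) (N t))
      (Icc 0 1) t := by
  have : IsManifold 𝓘(ℝ, E) 1 P := IsManifold.of_le (n := ∞) (by norm_cast)
  have he : (chartAt E p).MDifferentiable 𝓘(ℝ, E) 𝓘(ℝ, E) := mdifferentiable_chart p
  have h := (he.mdifferentiableAt hs).hasMFDerivAt.comp_hasMFDerivWithinAt t
    (hc.hasMFDerivWithinAt t ht)
  have h2 : HasFDerivWithinAt (fun t => chartAt E p (c t))
      ((1 : ℝ →L[ℝ] ℝ).smulRight (chartField Ω γ p (chartAt E p (c t)) (N t))) (Icc 0 1) t := by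
    refine (h.congr_mfderiv ?_).hasFDerivWithinAt
    refine ContinuousLinearMap.ext fun (r : ℝ) => ?_
    have h3 := map_smul (mfderiv 𝓘(ℝ, E) 𝓘(ℝ, E) (chartAt E p) (c t)) r
      (gaugeField Ω γ (c t) (N t))
    rw [← chartField_apply Ω γ hs] at h3
    exact h3
  simpa using! h2.hasDerivWithinAt

theorem of_chart {p : P} {y : ℝ → E} (hN : ContinuousOn N (Icc 0 1))
    (hy : ∀ t ∈ Icc (0 : ℝ) 1, y t ∈ (chartAt E p).target)
    (hd : ∀ t ∈ Icc (0 : ℝ) 1, HasDerivWithinAt y (chartField Ω γ p (y t) (N t)) (Icc 0 1) t) :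
    IsGaugeCurve Ω γ N fun t => (chartAt E p).symm (y t) where
  continuousOn_multiplier := hN
  hasMFDerivWithinAt t ht := by
    have : IsManifold 𝓘(ℝ, E) 1 P := IsManifold.of_le (n := ∞) (by norm_cast)
    have he : (chartAt E p).MDifferentiable 𝓘(ℝ, E) 𝓘(ℝ, E) := mdifferentiable_chart p
    have h := (he.mdifferentiableAt_symm (hy t ht)).hasMFDerivAt.comp_hasMFDerivWithinAt t
      (hd t ht).hasFDerivWithinAt.hasMFDerivWithinAt
    refine h.congr_mfderiv ?_
    refine ContinuousLinearMap.ext fun (r : ℝ) => ?_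
    change mfderiv 𝓘(ℝ, E) 𝓘(ℝ, E) (chartAt E p).symm (y t) (r • chartField Ω γ p (y t) (N t)) =
      r • gaugeField Ω γ ((chartAt E p).symm (y t)) (N t)
    have h2 := map_smul (mfderiv 𝓘(ℝ, E) 𝓘(ℝ, E) (chartAt E p).symm (y t)) r
      (chartField Ω γ p (y t) (N t))
    exact h2.trans (congrArg (r • ·) (mfderiv_chartAt_symm_chartField Ω γ (hy t ht) (N t)))

/-- A gauge curve which starts on the constraint surface stays there. -/
theorem mem_constraintSurface (hc : IsGaugeCurve Ω γ N c)
    (hγ : ∀ a, ContMDiff 𝓘(ℝ, E) 𝓘(ℝ, ℝ) ∞ (γ a)) (hreg : IsRegular E γ)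
    (hfirst : IsFirstClass Ω γ) (h0 : c 0 ∈ constraintSurface γ) :
    ∀ t ∈ Icc (0 : ℝ) 1, c t ∈ constraintSurface γ := by
  have hclosed : IsClosed (constraintSurface γ) := by
    have : constraintSurface γ = ⋂ a, γ a ⁻¹' {0} := by
      ext x
      simp [constraintSurface]
    rw [this]
    exact isClosed_iInter fun a => isClosed_singleton.preimage (hγ a).continuous
  -- The set of times spent on the surface is closed, so it suffices to extend it to the right of
  -- each such time. A short piece of the curve stays in one chart, where Grönwall's inequality
  -- applies with constant `C * B`, `B` bounding the rescaled multipliers.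
  refine IsClosed.Icc_subset_of_forall_mem_nhdsWithin (s := {t | c t ∈ constraintSurface γ}) ?_ h0
    fun t₀ ht₀ => ?_
  · rw [inter_comm]
    exact hc.continuousOn.preimage_isClosed_of_isClosed isClosed_Icc hclosed
  obtain ⟨hp, ht₀'⟩ := ht₀
  have h₀ := Ico_subset_Icc_self ht₀'
  set p := c t₀ with hpdef
  have hp' : p ∈ constraintSurface γ := hp
  set e := chartAt E p with he
  have hps : p ∈ e.source := mem_chart_source E p
  have hp0 : chartConstraint γ p (e p) = 0 := by
    rw [chartConstraint_eq_zero_iff, e.left_inv hps]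
    exact hp
  have hf := contDiffOn_chartConstraint hγ p
  obtain ⟨C, hC0, hC⟩ := exists_norm_fderiv_comp_le e.open_target (e.map_source hps) hf
    (range_fderiv_chartConstraint hγ hreg (e.map_source hps) hp0) hp0
    ((contDiffOn_chartField Ω hγ p).contDiffAt (e.open_target.mem_nhds (e.map_source hps)))
    (fun y hy hy0 => fderiv_chartConstraint_chartField Ω hγ hfirst hy hy0)
  have hO : {x | x ∈ e.source ∧ ‖fderiv ℝ (chartConstraint γ p) (e x) ∘L chartField Ω γ p (e x)‖ ≤
      C * ‖chartConstraint γ p (e x)‖} ∈ 𝓝 (c t₀) :=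
    inter_mem (e.open_source.mem_nhds hps) ((e.continuousAt hps).eventually hC)
  have hev := hc.eventually_subcurve_mem h₀ hO
  have hle : 𝓝[>] t₀ ≤ 𝓝[Icc 0 1] t₀ :=
    nhdsWithin_le_of_mem (mem_of_superset (Ioc_mem_nhdsGT ht₀'.2) fun t ht =>
      ⟨ht₀'.1.trans ht.1.le, ht.2⟩)
  filter_upwards [hle hev, hle self_mem_nhdsWithin] with t₁ ht₁ h₁
  have hd := hc.subcurve h₀ h₁
  obtain ⟨B, hB⟩ := isCompact_Icc.exists_bound_of_continuousOn hd.continuousOn_multiplier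
  have hz := eq_zero_of_norm_fderiv_le (f := chartConstraint γ p) (C := C * B)
    (fun τ hτ => hd.hasDerivWithinAt_chart (p := p) hτ (ht₁ τ hτ).1)
    (fun τ hτ => (hf.contDiffAt (e.open_target.mem_nhds
      (e.map_source (ht₁ τ hτ).1))).differentiableAt (by simp))
    (fun τ hτ => ?_) (by simpa [← hpdef] using hp0) 1 (by simp)
  · rw [chartConstraint_eq_zero_iff, e.left_inv (ht₁ 1 (by simp)).1] at hz
    simpa using hz
  · refine ((fderiv ℝ (chartConstraint γ p) _ ∘L chartField Ω γ p _).le_opNorm _).trans ?_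
    calc _ ≤ (C * ‖chartConstraint γ p (e (c (t₀ + τ * (t₁ - t₀))))‖) * B := by
          gcongr
          · exact (ht₁ τ hτ).2
          · exact hB τ hτ
      _ = _ := by ring

/-- A gauge curve in a box which starts on a plaque follows it as long as its projection stays in
the ball of parameters. -/
theorem eq_plaque (hc : IsGaugeCurve Ω γ N c) {p : P} {Z : Set E}
    {b : FlowBox (chartField Ω γ p) Z} {φ : EuclideanSpace ℝ (Fin M) → E} (hφ : b.IsPlaque φ)
    (hs : ∀ t ∈ Icc (0 : ℝ) 1, c t ∈ (chartAt E p).source)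
    (hU : ∀ t ∈ Icc (0 : ℝ) 1, chartAt E p (c t) ∈ b.U)
    (hball : ∀ t ∈ Icc (0 : ℝ) 1, b.proj (chartAt E p (c t)) ∈ ball b.center b.radius)
    (h0 : chartAt E p (c 0) = φ (b.proj (chartAt E p (c 0)))) :
    ∀ t ∈ Icc (0 : ℝ) 1, chartAt E p (c t) = φ (b.proj (chartAt E p (c t))) := by
  set y : ℝ → E := fun t => chartAt E p (c t) with hy
  have hyd : ∀ t ∈ Icc (0 : ℝ) 1,
      HasDerivWithinAt y (chartField Ω γ p (y t) (N t)) (Icc 0 1) t :=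
    fun t ht => hc.hasDerivWithinAt_chart ht (hs t ht)
  have hyc : ContinuousOn y (Icc 0 1) := fun t ht => (hyd t ht).continuousWithinAt
  set n : ℝ → EuclideanSpace ℝ (Fin M) := fun t => b.proj (chartField Ω γ p (y t) (N t)) with hn
  have hnc : ContinuousOn n (Icc 0 1) :=
    b.proj.continuous.comp_continuousOn
      ((b.continuousOn_X.comp hyc hU).clm_apply hc.continuousOn_multiplier)
  obtain ⟨B, hB⟩ := isCompact_Icc.exists_bound_of_continuousOn hnc
  have hσ : ∀ t ∈ Icc (0 : ℝ) 1, HasDerivWithinAt (fun t => b.proj (y t)) (n t) (Icc 0 1) t :=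
    fun t ht => b.proj.hasFDerivAt.comp_hasDerivWithinAt t (hyd t ht)
  have hφσ : ∀ t ∈ Icc (0 : ℝ) 1, HasDerivWithinAt (fun t => φ (b.proj (y t)))
      (chartField Ω γ p (φ (b.proj (y t))) (b.G (φ (b.proj (y t))) (n t))) (Icc 0 1) t :=
    fun t ht => by
      have h := (hφ _ (hball t ht)).2.2.2.comp_hasDerivWithinAt t (hσ t ht)
      exact h
  -- Both the curve and its projection lifted to the plaque solve `z' = X(z) (G(z) n(t))`, where `n`
  -- is the velocity of the projected curve. They start at the same point.
  refine ODE_solution_unique_of_mem_Icc_right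
    (v := fun t z => chartField Ω γ p z (b.G z (n t))) (s := fun _ => b.U)
    (K := b.K * B.toNNReal)
    (fun t ht => LipschitzOnWith.of_dist_le_mul fun z hz z' hz' => ?_) hyc
    (fun t ht => ?_) (fun t ht => hU t (Ico_subset_Icc_self ht))
    (fun t ht => (hφσ t ht).continuousWithinAt)
    (fun t ht => (hφσ t (Ico_subset_Icc_self ht)).mono_of_mem_nhdsWithin
      (Icc_mem_nhdsGE_of_mem ht))
    (fun t ht => (hφ _ (hball t (Ico_subset_Icc_self ht))).1) h0
  · have h1 := b.lipschitzOn_frame.dist_le_mul z hz z' hz'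
    have h2 := hB t (Ico_subset_Icc_self ht)
    rw [dist_eq_norm] at h1
    rw [dist_eq_norm]
    calc _ ≤ ‖chartField Ω γ p z ∘L b.G z - chartField Ω γ p z' ∘L b.G z'‖ * ‖n t‖ :=
          (chartField Ω γ p z ∘L b.G z - chartField Ω γ p z' ∘L b.G z').le_opNorm (n t)
      _ ≤ (b.K * dist z z') * B.toNNReal := by
          gcongr
          exact h2.trans (Real.le_coe_toNNReal B)
      _ = _ := by push_cast; ring
  · have h1 := (hyd t (Ico_subset_Icc_self ht)).mono_of_mem_nhdsWithin (Icc_mem_nhdsGE_of_mem ht)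
    simp only [hn]
    rwa [b.G_proj_X _ (hU t (Ico_subset_Icc_self ht))]

end IsGaugeCurve

variable [IsManifold 𝓘(ℝ, E) ∞ P]

/-- Straight segments in the ball of parameters give gauge curves in the plaque. -/
theorem exists_isGaugeCurve_plaque {p : P} {Z : Set E}
    {b : FlowBox (chartField Ω γ p) Z} (hbU : b.U ⊆ (chartAt E p).target)
    {φ : EuclideanSpace ℝ (Fin M) → E} (hφ : b.IsPlaque φ) {s₀ s₁ : EuclideanSpace ℝ (Fin M)}
    (h₀ : s₀ ∈ ball b.center b.radius) (h₁ : s₁ ∈ ball b.center b.radius) :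
    ∃ N, IsGaugeCurve Ω γ N fun t => (chartAt E p).symm (φ (s₀ + t • (s₁ - s₀))) := by
  have hmem : ∀ t ∈ Icc (0 : ℝ) 1, s₀ + t • (s₁ - s₀) ∈ ball b.center b.radius := fun t ht =>
    (convex_ball _ _).add_smul_sub_mem h₀ h₁ ht
  have hl : ∀ t, HasDerivWithinAt (fun t : ℝ => s₀ + t • (s₁ - s₀)) (s₁ - s₀) (Icc 0 1) t :=
    fun t => by
      simpa using ((hasDerivWithinAt_id t (Icc (0 : ℝ) 1)).smul_const (s₁ - s₀)).const_add s₀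
  have hd : ∀ t ∈ Icc (0 : ℝ) 1, HasDerivWithinAt (fun t : ℝ => φ (s₀ + t • (s₁ - s₀)))
      (chartField Ω γ p (φ (s₀ + t • (s₁ - s₀))) (b.G (φ (s₀ + t • (s₁ - s₀))) (s₁ - s₀)))
      (Icc 0 1) t := fun t ht => by
    have h := (hφ _ (hmem t ht)).2.2.2.comp_hasDerivWithinAt t (hl t)
    exact h
  -- The factor `G` converts the constant parameter velocity `s₁ - s₀` into multipliers of the
  -- original fields.
  refine ⟨fun t => b.G (φ (s₀ + t • (s₁ - s₀))) (s₁ - s₀), IsGaugeCurve.of_chart ?_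
    (fun t ht => hbU (hφ _ (hmem t ht)).1) hd⟩
  exact (b.continuousOn_G.comp (fun t ht => (hd t ht).continuousWithinAt)
    fun t ht => (hφ _ (hmem t ht)).1).clm_apply continuousOn_const

theorem gaugeStep_plaque {p : P} {Z : Set E}
    {b : FlowBox (chartField Ω γ p) Z} (hbU : b.U ⊆ (chartAt E p).target)
    {φ : EuclideanSpace ℝ (Fin M) → E} (hφ : b.IsPlaque φ) {s₀ s₁ : EuclideanSpace ℝ (Fin M)}
    (h₀ : s₀ ∈ ball b.center b.radius) (h₁ : s₁ ∈ ball b.center b.radius) :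
    GaugeStep Ω γ ((chartAt E p).symm (φ s₀)) ((chartAt E p).symm (φ s₁)) := by
  obtain ⟨N, hN⟩ := exists_isGaugeCurve_plaque hbU hφ h₀ h₁
  exact gaugeStep_iff.2 ⟨N, _, hN, by simp, by simp⟩

/-- The gauge orbit of a point of the constraint surface lies in that surface. -/
theorem gaugeOrbit_subset (hγ : ∀ a, ContMDiff 𝓘(ℝ, E) 𝓘(ℝ, ℝ) ∞ (γ a)) (hreg : IsRegular E γ)
    (hfirst : IsFirstClass Ω γ) {x : P} (hx : x ∈ constraintSurface γ) :
    gaugeOrbit Ω γ x ⊆ constraintSurface γ := by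
  intro y hy
  induction hy with
  | refl => exact hx
  | tail _ hstep ih =>
    obtain ⟨N, c, hc, rfl, rfl⟩ := gaugeStep_iff.1 hstep
    exact hc.mem_constraintSurface hγ hreg hfirst ih 1 (by simp)

end GaugeCurve

/-! ### Countability from connectedness. -/

/-- A connected space with an open cover by second countable sets, each of which meets only
countably many others, is second countable. -/
theorem secondCountableTopology_of_countable_meeting {X : Type*} [TopologicalSpace X]
    [PreconnectedSpace X] {S : Set (Set X)} (hopen : ∀ s ∈ S, IsOpen s) (hcov : ⋃₀ S = univ)
    (hsc : ∀ s ∈ S, SecondCountableTopology s)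
    (hcount : ∀ s ∈ S, {t ∈ S | (s ∩ t).Nonempty}.Countable) : SecondCountableTopology X := by
  rcases isEmpty_or_nonempty X with hX | ⟨⟨x₀⟩⟩
  · infer_instance
  obtain ⟨s₀, hs₀, hx₀⟩ : x₀ ∈ ⋃₀ S := hcov ▸ mem_univ x₀
  -- `A n` consists of the members of the cover at the end of a chain of `n` successively meeting
  -- members starting at `s₀`.
  let A : ℕ → Set (Set X) := fun n =>
    Nat.rec {s₀} (fun _ a => ⋃ s ∈ a, {t ∈ S | (s ∩ t).Nonempty}) n
  have hA : ∀ n, A n ⊆ S ∧ (A n).Countable := fun n => by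
    induction n with
    | zero => exact ⟨singleton_subset_iff.2 hs₀, countable_singleton _⟩
    | succ n ih =>
      exact ⟨iUnion₂_subset fun s _ t ht => ht.1, ih.2.biUnion fun s hs => hcount s (ih.1 hs)⟩
  have hW : ⋃₀ (⋃ n, A n) = univ := by
    -- If a member of the cover meets the union of all chains, it prolongs a chain. So a member
    -- through a point outside the union is disjoint from it.
    refine IsClopen.eq_univ ⟨?_, ?_⟩ ⟨x₀, s₀, mem_iUnion.2 ⟨0, rfl⟩, hx₀⟩
    · rw [← isOpen_compl_iff, isOpen_iff_mem_nhds]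
      intro y hy
      obtain ⟨t, htS, hyt⟩ : y ∈ ⋃₀ S := hcov ▸ mem_univ y
      filter_upwards [(hopen t htS).mem_nhds hyt] with z hzt hz
      obtain ⟨s, hs, hzs⟩ := hz
      obtain ⟨n, hn⟩ := mem_iUnion.1 hs
      refine hy ⟨t, mem_iUnion.2 ⟨n + 1, ?_⟩, hyt⟩
      exact mem_iUnion₂.2 ⟨s, hn, htS, z, hzs, hzt⟩
    · refine isOpen_sUnion fun s hs => ?_
      obtain ⟨n, hn⟩ := mem_iUnion.1 hs
      exact hopen s ((hA n).1 hn)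
  have hAS : ∀ s ∈ ⋃ n, A n, s ∈ S := fun s hs => by
    obtain ⟨n, hn⟩ := mem_iUnion.1 hs
    exact (hA n).1 hn
  have : Countable (⋃ n, A n) := (countable_iUnion fun n => (hA n).2).to_subtype
  have hsc' : ∀ s : ↥(⋃ n, A n), SecondCountableTopology (s : Set X) := fun s =>
    hsc s (hAS s s.2)
  refine TopologicalSpace.secondCountableTopology_of_countable_cover
    (U := fun s : ↥(⋃ n, A n) => (s : Set X)) (fun s => hopen s (hAS s s.2)) ?_
  rw [← hW, sUnion_eq_iUnion]

/-! ### The manifold structure on a gauge orbit. -/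

section Leaf

variable {E : Type*} [NormedAddCommGroup E] [NormedSpace ℝ E] [FiniteDimensional ℝ E]
  {P : Type*} [TopologicalSpace P] [ChartedSpace E P]
  {Ω : SymplecticForm E P} {M : ℕ} {γ : Fin M → P → ℝ}

variable (Ω γ) in
/-- A choice of boxes for the gauge fields around all points of the constraint surface. -/
structure GaugeFoliation where
  box : ∀ p : constraintSurface γ,
    FlowBox (chartField Ω γ (p : P)) {y | chartConstraint γ (p : P) y = 0}
  box_subset : ∀ p, (box p).U ⊆ (chartAt E (p : P)).target
  mem_core : ∀ p, chartAt E (p : P) p ∈ (box p).core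
  orbit_subset : ∀ x ∈ constraintSurface γ, gaugeOrbit Ω γ x ⊆ constraintSurface γ

/-- The gauge orbit of `x`, to be equipped with its leaf topology. -/
def Leaf (_ : GaugeFoliation Ω γ) (x : constraintSurface γ) : Type _ := {y : P // y ∈ gaugeOrbit Ω γ (x : P)}

variable {D : GaugeFoliation Ω γ} {x : constraintSurface γ}

/-- The inclusion of the leaf into phase space. -/
def Leaf.val (l : Leaf D x) : P := Subtype.val l

theorem Leaf.val_mem (l : Leaf D x) : l.val ∈ gaugeOrbit Ω γ (x : P) := Subtype.property l

theorem Leaf.val_injective : Function.Injective (Leaf.val : Leaf D x → P) :=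
  Subtype.val_injective

theorem Leaf.range_val : range (Leaf.val : Leaf D x → P) = gaugeOrbit Ω γ (x : P) :=
  Subtype.range_val

/-- A point of the orbit as a point of the leaf. -/
def Leaf.mk (y : P) (hy : y ∈ gaugeOrbit Ω γ (x : P)) : Leaf D x := ⟨y, hy⟩

instance : Inhabited (Leaf D x) := ⟨Leaf.mk x Relation.ReflTransGen.refl⟩

variable (D x) in
/-- A plaque of the leaf, in one of the chosen boxes. -/
structure Plaque where
  base : constraintSurface γ
  param : EuclideanSpace ℝ (Fin M) → E
  isPlaque : (D.box base).IsPlaque param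
  mem_orbit : ∀ s ∈ ball (D.box base).center (D.box base).radius,
    (chartAt E (base : P)).symm (param s) ∈ gaugeOrbit Ω γ (x : P)

variable (D) in
/-- The region of phase space in which the plaques of the box at `p` are closed. -/
def GaugeFoliation.region (p : constraintSurface γ) : Set P :=
  {z | z ∈ (chartAt E (p : P)).source ∧ chartAt E (p : P) z ∈ (D.box p).U ∧
    (D.box p).proj (chartAt E (p : P) z) ∈ ball (D.box p).center (D.box p).radius}

theorem GaugeFoliation.isOpen_region (p : constraintSurface γ) : IsOpen (D.region p) := by
  have h := (chartAt E (p : P)).isOpen_inter_preimage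
    ((D.box p).isOpen_U.inter (isOpen_ball.preimage (D.box p).proj.continuous) :
      IsOpen ((D.box p).U ∩ (D.box p).proj ⁻¹' ball (D.box p).center (D.box p).radius))
  exact h

namespace Plaque

/-- The ball of parameters of a plaque. -/
abbrev domain (q : Plaque D x) : Set (EuclideanSpace ℝ (Fin M)) :=
  ball (D.box q.base).center (D.box q.base).radius

/-- The parametrization of a plaque, as a map to phase space. -/
noncomputable def toPhase (q : Plaque D x) (s : EuclideanSpace ℝ (Fin M)) : P :=
  (chartAt E (q.base : P)).symm (q.param s)

/-- The coordinates of a plaque. -/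
noncomputable def coord (q : Plaque D x) (z : P) : EuclideanSpace ℝ (Fin M) :=
  (D.box q.base).proj (chartAt E (q.base : P) z)

/-- The points of a plaque. -/
def carrier (q : Plaque D x) : Set P :=
  {z | z ∈ (chartAt E (q.base : P)).source ∧ q.coord z ∈ q.domain ∧
    chartAt E (q.base : P) z = q.param (q.coord z)}

theorem carrier_subset_region (q : Plaque D x) : q.carrier ⊆ D.region q.base := fun z hz =>
  ⟨hz.1, by rw [hz.2.2]; exact (q.isPlaque _ hz.2.1).1, hz.2.1⟩

theorem param_mem_target (q : Plaque D x) {s} (hs : s ∈ q.domain) :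
    q.param s ∈ (chartAt E (q.base : P)).target :=
  D.box_subset _ (q.isPlaque s hs).1

theorem coord_toPhase (q : Plaque D x) {s} (hs : s ∈ q.domain) : q.coord (q.toPhase s) = s := by
  rw [coord, toPhase, (chartAt E (q.base : P)).right_inv (q.param_mem_target hs)]
  exact (q.isPlaque s hs).2.2.1

theorem toPhase_mem_carrier (q : Plaque D x) {s} (hs : s ∈ q.domain) :
    q.toPhase s ∈ q.carrier := by
  refine ⟨(chartAt E (q.base : P)).map_target (q.param_mem_target hs), ?_, ?_⟩
  · rwa [q.coord_toPhase hs]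
  · rw [q.coord_toPhase hs]
    exact (chartAt E (q.base : P)).right_inv (q.param_mem_target hs)

theorem toPhase_coord (q : Plaque D x) {z : P} (hz : z ∈ q.carrier) :
    q.toPhase (q.coord z) = z := by
  rw [toPhase, ← hz.2.2, (chartAt E (q.base : P)).left_inv hz.1]

open scoped Classical in
/-- The chart of the leaf given by a plaque. -/
noncomputable def chart (q : Plaque D x) : PartialEquiv (Leaf D x) (EuclideanSpace ℝ (Fin M)) where
  toFun l := q.coord l.val
  -- Outside the parameter ball the base point of the orbit is an arbitrary value.
  invFun s := if hs : s ∈ q.domain then Leaf.mk (q.toPhase s) (q.mem_orbit s hs) else default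
  source := Leaf.val ⁻¹' q.carrier
  target := q.domain
  map_source' _ hl := hl.2.1
  map_target' s hs := by
    rw [dif_pos hs]
    exact q.toPhase_mem_carrier hs
  left_inv' l hl := by
    rw [dif_pos hl.2.1]
    exact Leaf.val_injective (q.toPhase_coord hl)
  right_inv' s hs := by
    rw [dif_pos hs]
    exact q.coord_toPhase hs

theorem val_chart_symm (q : Plaque D x) {s} (hs : s ∈ q.domain) :
    (q.chart.symm s).val = q.toPhase s := by
  change Leaf.val (@dite _ (s ∈ q.domain) (Classical.propDecidable _) _ _) = _
  rw [dif_pos hs]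
  rfl

variable [IsManifold 𝓘(ℝ, E) ∞ P]

/-- A gauge curve in the region of a plaque which starts on the plaque stays on it. -/
theorem mem_carrier_of_isGaugeCurve (q : Plaque D x) {N : ℝ → EuclideanSpace ℝ (Fin M)} {c : ℝ → P}
    (hc : IsGaugeCurve Ω γ N c) (hreg : ∀ t ∈ Icc (0 : ℝ) 1, c t ∈ D.region q.base)
    (h0 : c 0 ∈ q.carrier) : c 1 ∈ q.carrier :=
  ⟨(hreg 1 (by simp)).1, (hreg 1 (by simp)).2.2,
    hc.eq_plaque q.isPlaque (fun t ht => (hreg t ht).1) (fun t ht => (hreg t ht).2.1)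
      (fun t ht => (hreg t ht).2.2) h0.2.2 1 (by simp)⟩

theorem contMDiffAt_toPhase (q : Plaque D x) {s} (hs : s ∈ q.domain) :
    ContMDiffAt 𝓘(ℝ, EuclideanSpace ℝ (Fin M)) 𝓘(ℝ, E) ∞ q.toPhase s := by
  have h1 : ContMDiffAt 𝓘(ℝ, E) 𝓘(ℝ, E) ∞ (chartAt E (q.base : P)).symm (q.param s) :=
    contMDiffOn_chart_symm.contMDiffAt
      ((chartAt E (q.base : P)).open_target.mem_nhds (q.param_mem_target hs))
  exact h1.comp s (q.isPlaque.contDiffOn.contDiffAt (isOpen_ball.mem_nhds hs)).contMDiffAt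

theorem contMDiffAt_coord (q : Plaque D x) {z : P} (hz : z ∈ (chartAt E (q.base : P)).source) :
    ContMDiffAt 𝓘(ℝ, E) 𝓘(ℝ, EuclideanSpace ℝ (Fin M)) ∞ q.coord z := by
  have h1 : ContMDiffAt 𝓘(ℝ, E) 𝓘(ℝ, E) ∞ (chartAt E (q.base : P)) z :=
    contMDiffOn_chart.contMDiffAt ((chartAt E (q.base : P)).open_source.mem_nhds hz)
  exact (D.box q.base).proj.contDiff.contMDiff.contMDiffAt.comp z h1

/-- The intersection of two plaques is open in each. -/
theorem eventually_toPhase_mem (q q' : Plaque D x) {s₀} (hs₀ : s₀ ∈ q.domain)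
    (h : q.toPhase s₀ ∈ q'.carrier) :
    ∀ᶠ s in 𝓝 s₀, s ∈ q.domain ∧ q.toPhase s ∈ q'.carrier := by
  have hcont : ContinuousAt q.toPhase s₀ := (q.contMDiffAt_toPhase hs₀).continuousAt
  have hn : ∀ᶠ s in 𝓝 s₀, s ∈ q.domain ∧ q.toPhase s ∈ D.region q'.base :=
    (isOpen_ball.eventually_mem hs₀).and
      (hcont ((D.isOpen_region _).mem_nhds (q'.carrier_subset_region h)))
  obtain ⟨ε, hε, hball⟩ := Metric.eventually_nhds_iff_ball.1 hn
  filter_upwards [ball_mem_nhds s₀ hε] with s hs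
  refine ⟨(hball s hs).1, ?_⟩
  -- The segment from `s₀` to `s` is a gauge curve in `q` which stays in the open region of `q'`.
  -- Starting on `q'`, it cannot leave it.
  obtain ⟨N, hN⟩ := exists_isGaugeCurve_plaque (D.box_subset _) q.isPlaque hs₀ (hball s hs).1
  have := q'.mem_carrier_of_isGaugeCurve hN
    (fun t ht => (hball _ ((convex_ball s₀ ε).add_smul_sub_mem (mem_ball_self hε) hs ht)).2)
    (by simpa [toPhase] using h)
  simpa [toPhase] using this

/-- Two plaques of the same box which meet coincide. -/
theorem carrier_subset_of_meet (q q' : Plaque D x) (hb : q.base = q'.base) {z : P}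
    (hz : z ∈ q.carrier) (hz' : z ∈ q'.carrier) : q.carrier ⊆ q'.carrier := fun w hw => by
  obtain ⟨N, hN⟩ := exists_isGaugeCurve_plaque (D.box_subset _) q.isPlaque hz.2.1 hw.2.1
  have h := q'.mem_carrier_of_isGaugeCurve hN
    (fun t ht => hb ▸ q.carrier_subset_region (q.toPhase_mem_carrier
      ((convex_ball _ _).add_smul_sub_mem hz.2.1 hw.2.1 ht)))
    (by
      have := q.toPhase_coord hz
      rw [toPhase] at this
      simpa [this] using hz')
  have h2 := q.toPhase_coord hw
  rw [toPhase] at h2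
  simpa [h2] using h

variable (D) in
/-- There is a plaque through each point of the core of a box. -/
theorem exists_mem_carrier (p : constraintSurface γ) {z : P} (hz : z ∈ gaugeOrbit Ω γ (x : P))
    (hs : z ∈ (chartAt E (p : P)).source) (hcore : chartAt E (p : P) z ∈ (D.box p).core) :
    ∃ q : Plaque D x, q.base = p ∧ z ∈ q.carrier := by
  have hz0 : chartConstraint γ (p : P) (chartAt E (p : P) z) = 0 := by
    rw [chartConstraint_eq_zero_iff, (chartAt E (p : P)).left_inv hs]
    exact D.orbit_subset x x.2 hz
  obtain ⟨hπ, φ, hφz, hφ⟩ := (D.box p).exists_plaque _ hcore hz0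
  have hφ' : (D.box p).IsPlaque φ := hφ
  refine ⟨⟨p, φ, hφ', fun s hs' => hz.tail ?_⟩, rfl, hs, hπ, hφz.symm⟩
  have h := gaugeStep_plaque (D.box_subset p) hφ' hπ hs'
  rwa [hφz, (chartAt E (p : P)).left_inv hs] at h

variable (D) in
theorem exists_mem_carrier_self {z : P} (hz : z ∈ gaugeOrbit Ω γ (x : P)) :
    ∃ q : Plaque D x, z ∈ q.carrier := by
  obtain ⟨q, -, hq⟩ := exists_mem_carrier D ⟨z, D.orbit_subset x x.2 hz⟩ hz
    (mem_chart_source E z) (D.mem_core _)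
  exact ⟨q, hq⟩

end Plaque

variable [IsManifold 𝓘(ℝ, E) ∞ P]

theorem Leaf.isOpen_trans_source (q q' : Plaque D x) :
    IsOpen (q.chart.symm.trans q'.chart).source := by
  rw [isOpen_iff_mem_nhds]
  intro s hs
  have hs' : s ∈ q.domain := hs.1
  have h : (q.chart.symm s).val ∈ q'.carrier := hs.2
  rw [q.val_chart_symm hs'] at h
  filter_upwards [q.eventually_toPhase_mem q' hs' h] with t ht
  refine ⟨ht.1, ?_⟩
  change (q.chart.symm t).val ∈ q'.carrier
  rw [q.val_chart_symm ht.1]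
  exact ht.2

/-- The transition map agrees with `q'.coord ∘ q.toPhase`, a composite of smooth maps through the
ambient manifold. -/
theorem Leaf.contDiffOn_trans (q q' : Plaque D x) :
    ContDiffOn ℝ ∞ (q.chart.symm.trans q'.chart) (q.chart.symm.trans q'.chart).source := by
  intro s hs
  have hs' : s ∈ q.domain := hs.1
  have h : (q.chart.symm s).val ∈ q'.carrier := hs.2
  rw [q.val_chart_symm hs'] at h
  have h1 : ContMDiffAt _ _ ∞ (q'.coord ∘ q.toPhase) s :=
    (q'.contMDiffAt_coord h.1).comp s (q.contMDiffAt_toPhase hs')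
  refine (contMDiffAt_iff_contDiffAt.1 h1).contDiffWithinAt.congr_of_mem (fun t ht => ?_) hs
  change q'.coord (q.chart.symm t).val = _
  rw [q.val_chart_symm ht.1]
  rfl

variable (D x) in
/-- The atlas of the leaf given by the plaques. -/
noncomputable def Leaf.core : ChartedSpaceCore (EuclideanSpace ℝ (Fin M)) (Leaf D x) where
  atlas := range Plaque.chart
  chartAt l := (Plaque.exists_mem_carrier_self D l.val_mem).choose.chart
  mem_chart_source l := (Plaque.exists_mem_carrier_self D l.val_mem).choose_spec
  chart_mem_atlas l := mem_range_self _
  open_source := by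
    rintro _ _ ⟨q, rfl⟩ ⟨q', rfl⟩
    exact Leaf.isOpen_trans_source q q'
  continuousOn_toFun := by
    rintro _ _ ⟨q, rfl⟩ ⟨q', rfl⟩
    exact (Leaf.contDiffOn_trans q q').continuousOn

noncomputable instance : TopologicalSpace (Leaf D x) := (Leaf.core D x).toTopologicalSpace

noncomputable instance : ChartedSpace (EuclideanSpace ℝ (Fin M)) (Leaf D x) :=
  (Leaf.core D x).toChartedSpace

/-- The chart of a plaque as a local homeomorphism. -/
noncomputable def Plaque.homeo (q : Plaque D x) :
    OpenPartialHomeomorph (Leaf D x) (EuclideanSpace ℝ (Fin M)) :=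
  (Leaf.core D x).openPartialHomeomorph q.chart (mem_range_self q)

theorem Leaf.exists_chartAt_eq (l : Leaf D x) :
    ∃ q : Plaque D x, chartAt (EuclideanSpace ℝ (Fin M)) l = q.homeo :=
  ⟨(Plaque.exists_mem_carrier_self D l.val_mem).choose, rfl⟩

instance : IsManifold (𝓡 M) ∞ (Leaf D x) := by
  refine isManifold_of_contDiffOn (𝓡 M) ∞ (Leaf D x) fun e e' he he' => ?_
  have h : ∀ e ∈ atlas (EuclideanSpace ℝ (Fin M)) (Leaf D x), ∃ q : Plaque D x, e = q.homeo := by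
    intro e he
    obtain ⟨f, hf⟩ := mem_iUnion.1 he
    obtain ⟨⟨q, rfl⟩, hf'⟩ := mem_iUnion.1 hf
    exact ⟨q, hf'⟩
  obtain ⟨q, rfl⟩ := h e he
  obtain ⟨q', rfl⟩ := h e' he'
  refine (Leaf.contDiffOn_trans q q').mono ?_
  rintro s ⟨hs, -⟩
  exact hs

theorem Leaf.val_eventuallyEq (q : Plaque D x) {l : Leaf D x} (hl : l ∈ q.homeo.source) :
    Leaf.val =ᶠ[𝓝 l] q.toPhase ∘ q.homeo := by
  filter_upwards [q.homeo.open_source.mem_nhds hl] with l' hl'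
  exact (q.toPhase_coord hl').symm

theorem Leaf.contMDiff_val : ContMDiff (𝓡 M) 𝓘(ℝ, E) ∞ (Leaf.val : Leaf D x → P) := by
  intro l
  obtain ⟨q, hq⟩ := l.exists_chartAt_eq
  have hl : l ∈ (chartAt (EuclideanSpace ℝ (Fin M)) l).source := mem_chart_source _ l
  have h1 : ContMDiffAt (𝓡 M) (𝓡 M) ∞ (chartAt (EuclideanSpace ℝ (Fin M)) l) l :=
    contMDiffOn_chart.contMDiffAt ((chartAt _ l).open_source.mem_nhds hl)
  rw [hq] at hl h1
  exact ((q.contMDiffAt_toPhase (q.homeo.map_source hl)).comp l h1).congr_of_eventuallyEq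
    (Leaf.val_eventuallyEq q hl)

instance [T2Space P] : T2Space (Leaf D x) :=
  T2Space.of_injective_continuous Leaf.val_injective Leaf.contMDiff_val.continuous

theorem Plaque.hasMFDerivAt_toPhase (q : Plaque D x) {s} (hs : s ∈ q.domain) :
    HasMFDerivAt 𝓘(ℝ, EuclideanSpace ℝ (Fin M)) 𝓘(ℝ, E) q.toPhase s
      ((mfderiv 𝓘(ℝ, E) 𝓘(ℝ, E) (chartAt E (q.base : P)).symm (q.param s)).comp
        (chartField Ω γ (q.base : P) (q.param s) ∘L (D.box q.base).G (q.param s))) := by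
  have : IsManifold 𝓘(ℝ, E) 1 P := IsManifold.of_le (n := ∞) (by norm_cast)
  have he : (chartAt E (q.base : P)).MDifferentiable 𝓘(ℝ, E) 𝓘(ℝ, E) := mdifferentiable_chart _
  exact (he.mdifferentiableAt_symm (q.param_mem_target hs)).hasMFDerivAt.comp s
    (q.isPlaque s hs).2.2.2.hasMFDerivAt

theorem Plaque.mfderiv_toPhase_injective (q : Plaque D x) {s} (hs : s ∈ q.domain) :
    Function.Injective (mfderiv 𝓘(ℝ, EuclideanSpace ℝ (Fin M)) 𝓘(ℝ, E) q.toPhase s) := by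
  rw [(q.hasMFDerivAt_toPhase hs).mfderiv]
  refine (mfderiv_chartAt_symm_bijective (E := E) (q.param_mem_target hs)).1.comp ?_
  intro v w hvw
  have h := (D.box q.base).proj_X_G _ (q.isPlaque s hs).1
  rw [← h v, ← h w]
  exact congrArg (D.box q.base).proj hvw

/-- On the box, `G` is inverse to `proj ∘ X`, so the change of frame does not alter the span. -/
theorem Plaque.range_mfderiv_toPhase (q : Plaque D x) {s} (hs : s ∈ q.domain) :
    range (mfderiv 𝓘(ℝ, EuclideanSpace ℝ (Fin M)) 𝓘(ℝ, E) q.toPhase s) =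
      Submodule.span ℝ (range fun a => Ω.hamiltonianField (γ a) (q.toPhase s)) := by
  rw [(q.hasMFDerivAt_toPhase hs).mfderiv, ← range_gaugeField]
  have hG := (D.box q.base).G_proj_X _ (q.isPlaque s hs).1
  have hX := mfderiv_chartAt_symm_chartField Ω γ (q.param_mem_target hs)
  ext w
  constructor
  · rintro ⟨v, rfl⟩
    exact ⟨(D.box q.base).G (q.param s) v, (hX _).symm⟩
  · rintro ⟨v, rfl⟩
    refine ⟨(D.box q.base).proj (chartField Ω γ (q.base : P) (q.param s) v), ?_⟩
    refine Eq.trans ?_ (hX v)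
    exact congrArg (fun u => mfderiv 𝓘(ℝ, E) 𝓘(ℝ, E) (chartAt E (q.base : P)).symm (q.param s)
      (chartField Ω γ (q.base : P) (q.param s) u)) (hG v)

/-- The inclusion of the leaf is an immersion with the gauge directions as tangent space. -/
theorem Leaf.mfderiv_val (l : Leaf D x) :
    Function.Injective (mfderiv (𝓡 M) 𝓘(ℝ, E) (Leaf.val : Leaf D x → P) l) ∧
      range (mfderiv (𝓡 M) 𝓘(ℝ, E) (Leaf.val : Leaf D x → P) l) =
        Submodule.span ℝ (range fun a => Ω.hamiltonianField (γ a) l.val) := by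
  have : IsManifold (𝓡 M) 1 (Leaf D x) := IsManifold.of_le (n := ∞) (by norm_cast)
  obtain ⟨q, hq⟩ := l.exists_chartAt_eq
  have hl : l ∈ (chartAt (EuclideanSpace ℝ (Fin M)) l).source := mem_chart_source _ l
  have he : (chartAt (EuclideanSpace ℝ (Fin M)) l).MDifferentiable (𝓡 M) (𝓡 M) :=
    mdifferentiable_chart l
  rw [hq] at hl he
  have hs : q.homeo l ∈ q.domain := q.homeo.map_source hl
  have hval : q.toPhase (q.homeo l) = l.val := q.toPhase_coord hl
  have h1 : mfderiv (𝓡 M) 𝓘(ℝ, E) (Leaf.val : Leaf D x → P) l =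
      mfderiv (𝓡 M) 𝓘(ℝ, E) (q.toPhase ∘ q.homeo) l :=
    (Leaf.val_eventuallyEq q hl).mfderiv_eq
  have h2 := mfderiv_comp l (q.hasMFDerivAt_toPhase hs).mdifferentiableAt
    (he.mdifferentiableAt hl)
  have h3 : ∀ v, mfderiv (𝓡 M) 𝓘(ℝ, E) (Leaf.val : Leaf D x → P) l v =
      mfderiv 𝓘(ℝ, EuclideanSpace ℝ (Fin M)) 𝓘(ℝ, E) q.toPhase (q.homeo l)
        (mfderiv (𝓡 M) (𝓡 M) q.homeo l v) := fun v => DFunLike.congr_fun (h1.trans h2) v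
  have hb := he.mfderiv_bijective hl
  constructor
  · intro v w hvw
    have h4 := (h3 v).symm.trans (hvw.trans (h3 w))
    exact hb.1 (q.mfderiv_toPhase_injective hs h4)
  · have h5 := q.range_mfderiv_toPhase hs
    rw [hval] at h5
    rw [← h5]
    ext w
    constructor
    · rintro ⟨v, rfl⟩
      exact ⟨_, (h3 v).symm⟩
    · rintro ⟨v, rfl⟩
      obtain ⟨u, rfl⟩ := hb.2 v
      exact ⟨u, h3 u⟩

/-- Gauge curves are continuous in the leaf topology. -/
theorem Leaf.continuous_mk {N : ℝ → EuclideanSpace ℝ (Fin M)} {c : ℝ → P}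
    (hc : IsGaugeCurve Ω γ N c)
    (hmem : ∀ t ∈ Icc (0 : ℝ) 1, c t ∈ gaugeOrbit Ω γ (x : P)) :
    Continuous fun t : Icc (0 : ℝ) 1 => (Leaf.mk (c t) (hmem t t.2) : Leaf D x) := by
  rw [continuous_iff_continuousAt]
  intro t₀
  obtain ⟨q, hq⟩ := Plaque.exists_mem_carrier_self D (hmem t₀ t₀.2)
  have hev := hc.eventually_subcurve_mem t₀.2
    ((D.isOpen_region q.base).mem_nhds (q.carrier_subset_region hq))
  have hev' : ∀ᶠ t : Icc (0 : ℝ) 1 in 𝓝 t₀, c t ∈ q.carrier := by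
    rw [nhds_subtype_eq_comap_nhdsWithin]
    refine (hev.comap _).mp ?_
    rw [← nhds_subtype_eq_comap_nhdsWithin]
    refine Eventually.of_forall fun t ht => ?_
    -- The time `t` may lie on either side of `t₀`, since gauge curves can be run backwards.
    have h := q.mem_carrier_of_isGaugeCurve (hc.subcurve t₀.2 t.2) ht (by simpa using hq)
    simpa using h
  refine (q.homeo.continuousAt_iff_continuousAt_comp_left (x := t₀)
    (f := fun t : Icc (0 : ℝ) 1 => (Leaf.mk (c t) (hmem t t.2) : Leaf D x)) hev').2 ?_
  have hcont : ContinuousAt (fun t : Icc (0 : ℝ) 1 => c t) t₀ :=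
    hc.continuousOn.domRestrict.continuousAt
  exact (q.contMDiffAt_coord hq.1).continuousAt.comp_of_eq hcont rfl

/-- Each gauge step is a continuous path in the leaf, so no step leaves the component of the base
point. -/
instance : ConnectedSpace (Leaf D x) := by
  have key : ∀ y, ∀ hy : y ∈ gaugeOrbit Ω γ (x : P),
      (Leaf.mk y hy : Leaf D x) ∈ connectedComponent (default : Leaf D x) := by
    intro y hy
    induction hy with
    | refl => exact mem_connectedComponent
    | @tail z w hz hstep ih =>
      obtain ⟨N, c, hc, rfl, rfl⟩ := gaugeStep_iff.1 hstep
      have hmem : ∀ t ∈ Icc (0 : ℝ) 1, c t ∈ gaugeOrbit Ω γ (x : P) := fun t ht =>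
        hz.tail (gaugeStep_iff.2 ⟨_, _, hc.subcurve (t₀ := 0) (by simp) ht, by simp, by simp⟩)
      have hpre := isPreconnected_range (Leaf.continuous_mk (D := D) hc hmem)
      rw [connectedComponent_eq ih]
      exact hpre.subset_connectedComponent ⟨⟨0, by simp⟩, rfl⟩ ⟨⟨1, by simp⟩, rfl⟩
  have : connectedComponent (default : Leaf D x) = univ :=
    eq_univ_of_forall fun l => key l.val l.val_mem
  exact connectedSpace_iff_connectedComponent.2 ⟨_, this⟩

/-- Leaf topology is finer than the subspace topology, so second countability is not inherited. It
comes from `secondCountableTopology_of_countable_meeting`, applied to all plaques in a countable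
family of boxes. -/
instance [SecondCountableTopology P] : SecondCountableTopology (Leaf D x) := by
  -- Lindelöf property of phase space: countably many cores cover the constraint surface.
  obtain ⟨T, hT, hTU⟩ := TopologicalSpace.isOpen_iUnion_countable
    (fun p : constraintSurface γ =>
      (chartAt E (p : P)).source ∩ chartAt E (p : P) ⁻¹' (D.box p).core)
    fun p => (chartAt E (p : P)).isOpen_inter_preimage (D.box p).isOpen_core
  set S : constraintSurface γ → Set (Set (Leaf D x)) := fun p =>
    {s | ∃ q : Plaque D x, q.base = p ∧ s = q.homeo.source} with hS
  have hdisj : ∀ p, (S p).PairwiseDisjoint id := by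
    rintro p _ ⟨q, hq, rfl⟩ _ ⟨q', hq', rfl⟩ hne
    refine disjoint_left.2 fun l hl hl' => hne ?_
    exact congrArg (fun s => (Leaf.val ⁻¹' s : Set (Leaf D x)))
      ((q.carrier_subset_of_meet q' (hq.trans hq'.symm) hl hl').antisymm
        (q'.carrier_subset_of_meet q (hq'.trans hq.symm) hl' hl))
  have hopen : ∀ p, ∀ s ∈ S p, IsOpen s := by
    rintro p _ ⟨q, -, rfl⟩
    exact q.homeo.open_source
  have hsc : ∀ p, ∀ s ∈ S p, SecondCountableTopology s := by
    rintro p _ ⟨q, -, rfl⟩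
    exact q.homeo.secondCountableTopology_source
  refine secondCountableTopology_of_countable_meeting (S := ⋃ p ∈ T, S p) ?_ ?_ ?_ ?_
  · intro s hs
    obtain ⟨p, -, hp⟩ := mem_iUnion₂.1 hs
    exact hopen p s hp
  · refine eq_univ_of_forall fun l => ?_
    have hl : l.val ∈ ⋃ p : constraintSurface γ,
        (chartAt E (p : P)).source ∩ chartAt E (p : P) ⁻¹' (D.box p).core :=
      mem_iUnion.2 ⟨⟨l.val, D.orbit_subset x x.2 l.val_mem⟩, mem_chart_source E l.val,
        D.mem_core _⟩
    rw [← hTU] at hl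
    obtain ⟨p, hpT, hp⟩ := mem_iUnion₂.1 hl
    obtain ⟨q, hq, hlq⟩ := Plaque.exists_mem_carrier D p l.val_mem hp.1 hp.2
    exact ⟨q.homeo.source, mem_iUnion₂.2 ⟨p, hpT, q, hq, rfl⟩, hlq⟩
  · intro s hs
    obtain ⟨p, -, hp⟩ := mem_iUnion₂.1 hs
    exact hsc p s hp
  · intro s hs
    obtain ⟨p₀, -, hp₀⟩ := mem_iUnion₂.1 hs
    have := hsc p₀ s hp₀
    have hsub : {t ∈ ⋃ p ∈ T, S p | (s ∩ t).Nonempty} ⊆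
        ⋃ p ∈ T, {t ∈ S p | (s ∩ t).Nonempty} := by
      rintro t ⟨ht, hne⟩
      obtain ⟨p, hpT, hp⟩ := mem_iUnion₂.1 ht
      exact mem_iUnion₂.2 ⟨p, hpT, hp, hne⟩
    refine (hT.biUnion fun p _ => ?_).mono hsub
    -- The plaques of one box cut `s` in disjoint nonempty open sets, and `s` is second countable,
    -- so there are countably many.
    refine Set.PairwiseDisjoint.countable_of_isOpen (α := s)
      (s := fun t : Set (Leaf D x) => (Subtype.val ⁻¹' t : Set s)) ?_ ?_ ?_
    · intro t ht t' ht' hne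
      exact (hdisj p ht.1 ht'.1 hne).preimage _
    · intro t ht
      exact (hopen p t ht.1).preimage continuous_subtype_val
    · rintro t ⟨-, z, hzs, hzt⟩
      exact ⟨⟨z, hzs⟩, hzt⟩

/-- The constraint surface of regular first class constraints is foliated by gauge orbits. -/
theorem nonempty_gaugeFoliation (hγ : ∀ a, ContMDiff 𝓘(ℝ, E) 𝓘(ℝ, ℝ) ∞ (γ a))
    (hreg : IsRegular E γ) (hfirst : IsFirstClass Ω γ) : Nonempty (GaugeFoliation Ω γ) := by
  choose b hb using fun p : constraintSurface γ => exists_gaugeBox Ω hγ hreg hfirst p.2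
  exact ⟨⟨b, fun p => (hb p).1, fun p => (hb p).2,
    fun x hx => gaugeOrbit_subset hγ hreg hfirst hx⟩⟩

end Leaf

end ConstrainedSystem

theorem theorem5 {E : Type u} [NormedAddCommGroup E] [NormedSpace ℝ E] [FiniteDimensional ℝ E]
    {P : Type v} [TopologicalSpace P] [T2Space P] [SecondCountableTopology P]
    [ChartedSpace E P] [IsManifold 𝓘(ℝ, E) ∞ P]
    (Ω : ConstrainedSystem.SymplecticForm E P)
    {M : ℕ} (γ : Fin M → P → ℝ)
    (hsmooth : ∀ a, ContMDiff 𝓘(ℝ, E) 𝓘(ℝ, ℝ) ∞ (γ a))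
    (hregular : ConstrainedSystem.IsRegular E γ)
    (hfirst : ConstrainedSystem.IsFirstClass Ω γ)
    (x : P) (hx : x ∈ ConstrainedSystem.constraintSurface γ) :
    ConstrainedSystem.gaugeOrbit Ω γ x ⊆ ConstrainedSystem.constraintSurface γ ∧
    ∃ (L : Type v) (_ : TopologicalSpace L) (_ : ChartedSpace (EuclideanSpace ℝ (Fin M)) L)
      (ι : L → P),
      IsManifold (𝓡 M) ∞ L ∧ T2Space L ∧ SecondCountableTopology L ∧ ConnectedSpace L ∧
      ContMDiff (𝓡 M) 𝓘(ℝ, E) ∞ ι ∧ Function.Injective ι ∧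
      Set.range ι = ConstrainedSystem.gaugeOrbit Ω γ x ∧
      ∀ l : L, Function.Injective (mfderiv (𝓡 M) 𝓘(ℝ, E) ι l) ∧
        Set.range (mfderiv (𝓡 M) 𝓘(ℝ, E) ι l) =
          Submodule.span ℝ (Set.range fun a => Ω.hamiltonianField (γ a) (ι l)) := by
  obtain ⟨D⟩ := ConstrainedSystem.nonempty_gaugeFoliation hsmooth hregular hfirst
  exact ⟨D.orbit_subset x hx, ConstrainedSystem.Leaf D ⟨x, hx⟩, inferInstance, inferInstance,
    ConstrainedSystem.Leaf.val, inferInstance, inferInstance, inferInstance, inferInstance,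
    ConstrainedSystem.Leaf.contMDiff_val, ConstrainedSystem.Leaf.val_injective,
    ConstrainedSystem.Leaf.range_val, ConstrainedSystem.Leaf.mfderiv_val⟩
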